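/- Let $\Gamma$ be a countable amenable group (amenable in the sense of Følner) which is residually finite and contains a non-torsion element with infinite conjugacy class. Then $\Gamma$ has property ID. Here the following terminology is used. For finite sets $F,S\subseteq\Gamma$ and $\delta>0$, the set $S$ is $(F,\delta)$-invariant if $|S\cap\bigcap_{t\in F}t^{-1}S|\ge(1-\delta)|S|$. A tiling of $\Gamma$ is a finite collection $\mathcal T$ of pairs $(S,C)$, where the shapes $S$ are nonempty finite subsets of $\Gamma$ and the center sets $C$ are pairwise disjoint subsets of $\Gamma$, such that $\Gamma=\bigsqcup_{(S,C)\in\mathcal T}\bigsqcup_{c\in C}Sc$; the sets $Sc$ are the tiles, and $c$ is a tiling center for $S$. A sequence $(\mathcal T_n)$ of tilings is - tightly nested if for every $n>1$ and $(S,C)\in\mathcal T_n$ there is a partition $S=\bigsqcup_{j\in J}S_jg_j$ with shapes $S_j$ of $\mathcal T_{n-1}$ and $g_j\in\Gamma$, such that $g_jc$ is a tiling center for $S_j$ in $\mathcal T_{n-1}$ for all $c\in C$ and $j\in J$; - a sequence of Følner tilings if for every finite $F\subseteq\Gamma$ and every $\delta>0$ there is an $N$ such that for all $n\ge N$ every shape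 of $\mathcal T_n$ is $(F,\delta)$-invariant. The entropy of a tiling $\mathcal T$ with set of shapes $\mathcal S$ is the topological entropy of the right shift action $(sx)_t=x_{ts}$ of $\Gamma$ on the closed set $\overline{\Gamma x}\subseteq(\mathcal S\sqcup\{0\})^\Gamma$, where $x_t=S$ if $t$ is a tiling center for $S$ and $x_t=0$ if $t$ is not a tiling center. The topological entropy of an action on a compact space is $\sup_{\mathcal U}\lim_n\frac1{|F_n|}\log N(\bigvee_{s\in F_n}s^{-1}\mathcal U)$, where $(F_n)$ is a (left) Følner sequence, $\mathcal U$ ranges over the finite open covers and $N(\cdot)$ is the minimal cardinality of a subcover (it does not depend on $(F_n)$). A set $C\subseteq\Gamma$ is syndetic if $FC=\Gamma$ for some finite $F\subseteq\Gamma$. The group $\Gamma$ has property ID if there are an infinite cyclic subgroup $H\subseteq\Gamma$ of infinite index and a tightly nested sequence $(\mathcal T_n)$ of Følner tilings with syndetic center sets and entropies converging to zero such that 1. every finite subset of $\Gamma$ is contained in some tile of some $\mathcal T_n$; 2. for every $\delta>0$ there is an $n_0$ such that $|H\cap T|\le\delta|T|$ for all $n\ge n_0$ and every tile $T$ of $\mathcal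 T_n$; 3. for every $n$ there are a shape $S$ of $\mathcal T_n$ and a subgroup $H_0$ of $H$ such that every $c\in H_0$ is a tiling center for $S$ in $\mathcal T_n$ and $H\subseteq\bigcup_{c\in H_0}Sc$. -/

import Mathlib

open Filter Topology

noncomputable section

namespace PropID

/-! ### Invariance, amenability and Følner sequences -/

section Invariance

variable {Γ : Type*} [Group Γ]

/-- `S` is `(F, δ)`-invariant: `|S ∩ ⋂_{t ∈ F} t⁻¹ S| ≥ (1 - δ) |S|`. -/
def IsInvariant (F : Finset Γ) (δ : ℝ) (S : Finset Γ) : Prop :=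
  (1 - δ) * (S.card : ℝ) ≤ (((S : Set Γ) ∩ ⋂ t ∈ F, {s : Γ | t * s ∈ S}).ncard : ℝ)

/-- `(F n)` is a (left) Følner sequence of nonempty finite sets. -/
def IsFolnerSeq (F : ℕ → Finset Γ) : Prop :=
  (∀ n, (F n).Nonempty) ∧
    ∀ (K : Finset Γ) (δ : ℝ), 0 < δ → ∃ N, ∀ n ≥ N, IsInvariant K δ (F n)

variable (Γ) in
/-- Amenability of a discrete group, in the form of the Følner condition. -/
def IsAmenable : Prop :=
  ∀ (K : Finset Γ) (δ : ℝ), 0 < δ → ∃ S : Finset Γ, S.Nonempty ∧ IsInvariant K δ S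

/-- `C` is syndetic: `F C = Γ` for some finite set `F`. -/
def IsSyndetic (C : Set Γ) : Prop :=
  ∃ F : Finset Γ, ∀ g : Γ, ∃ f ∈ F, ∃ c ∈ C, f * c = g

/-- The right translate `S c` of a finite set. -/
def rightTranslate (S : Finset Γ) (c : Γ) : Finset Γ :=
  S.map (mulRightEmbedding c)

end Invariance

/-! ### Topological entropy -/

section Entropy

variable {X : Type*}

/-- The minimal cardinality of a (finite) subcover of `𝒰`. -/
def coverNumber (𝒰 : Set (Set X)) : ℕ :=
  sInf {n | ∃ 𝒱 : Finset (Set X), (𝒱 : Set (Set X)) ⊆ 𝒰 ∧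
    ⋃₀ (𝒱 : Set (Set X)) = Set.univ ∧ 𝒱.card = n}

/-- The join `𝒰^F = ⋁_{s ∈ F} s⁻¹ 𝒰`. -/
def joinCover {Γ : Type*} [SMul Γ X] (F : Finset Γ) (𝒰 : Set (Set X)) : Set (Set X) :=
  {W | ∃ U : Γ → Set X, (∀ s ∈ F, U s ∈ 𝒰) ∧ W = ⋂ s ∈ F, {x : X | s • x ∈ U s}}

/-- `𝒰` is a finite open cover of `X`. -/
def IsFiniteOpenCover [TopologicalSpace X] (𝒰 : Set (Set X)) : Prop :=
  𝒰.Finite ∧ (∀ U ∈ 𝒰, IsOpen U) ∧ ⋃₀ 𝒰 = Set.univ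

/-- The topological entropy of an action `Γ ↷ X`, computed along the sequence `F` of finite sets:
`sup_𝒰 limsup_n |F_n|⁻¹ log N(𝒰^{F_n})`. For a Følner sequence of an amenable group acting
continuously on a compact space the upper limit is a limit, and does not depend on `F`. -/
def topEntropy {Γ : Type*} [Group Γ] (F : ℕ → Finset Γ) (X : Type*) [TopologicalSpace X]
    [MulAction Γ X] : EReal :=
  ⨆ (𝒰 : Set (Set X)) (_ : IsFiniteOpenCover 𝒰),
    limsup (fun n => ((Real.log (coverNumber (joinCover (F n) 𝒰)) / (F n).card : ℝ) : EReal)) atTop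

end Entropy

/-! ### The right shift -/

section Shift

/-- The space `A^Γ`, with the product of the discrete topologies and the right shift action
`(s x)_t = x_{t s}`. -/
def Shift (Γ A : Type*) : Type _ := Γ → A

variable {Γ A : Type*} [Group Γ]

instance : TopologicalSpace (Shift Γ A) :=
  @Pi.topologicalSpace Γ (fun _ => A) (fun _ => ⊥)

instance : MulAction Γ (Shift Γ A) where
  smul s x := fun t => x (t * s)
  one_smul x := funext fun t => congrArg x (mul_one t)
  mul_smul s r x := funext fun t => congrArg x (mul_assoc t s r).symm

theorem Shift.smul_apply (s : Γ) (x : Shift Γ A) (t : Γ) : (s • x) t = x (t * s) := rfl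

theorem Shift.continuous_smul (s : Γ) : Continuous fun x : Shift Γ A => s • x :=
  @continuous_pi _ _ _ _ (fun _ => ⊥) _ fun t =>
    @continuous_apply Γ (fun _ => A) (fun _ => ⊥) (t * s)

/-- The closure of the orbit `Γ x`, as a closed `Γ`-invariant set. -/
def orbitClosure (x : Shift Γ A) : SubMulAction Γ (Shift Γ A) where
  carrier := closure (MulAction.orbit Γ x)
  smul_mem' s _ hy :=
    map_mem_closure (Shift.continuous_smul s) hy fun _ hz =>
      MulAction.mem_orbit_of_mem_orbit s hz

end Shift

/-! ### Tilings -/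

section Tilings

variable {Γ : Type*} [Group Γ]

variable (Γ) in
/-- A tiling of `Γ`: a finite collection of pairs `(S, C)` of a nonempty finite shape and a set of
centers such that `Γ` is the disjoint union of the tiles `S c`, over all pairs and all `c ∈ C`.
Different pairs have disjoint center sets, so that a center determines the shape of its tile. -/
structure Tiling where
  pairs : Finset (Finset Γ × Set Γ)
  shape_nonempty : ∀ p ∈ pairs, p.1.Nonempty
  existsUnique_tile : ∀ g : Γ, ∃! q : (Finset Γ × Set Γ) × Γ,
    q.1 ∈ pairs ∧ q.2 ∈ q.1.2 ∧ g ∈ rightTranslate q.1.1 q.2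
  centers_disjoint : ∀ p ∈ pairs, ∀ q ∈ pairs, p ≠ q → Disjoint p.2 q.2

namespace Tiling

/-- `S` is a shape of the tiling. -/
def IsShape (𝒯 : Tiling Γ) (S : Finset Γ) : Prop :=
  ∃ C : Set Γ, (S, C) ∈ 𝒯.pairs

/-- `c` is a tiling center for the shape `S`. -/
def IsCenter (𝒯 : Tiling Γ) (S : Finset Γ) (c : Γ) : Prop :=
  ∃ C : Set Γ, (S, C) ∈ 𝒯.pairs ∧ c ∈ C

/-- `T` is a tile of the tiling. -/
def IsTile (𝒯 : Tiling Γ) (T : Finset Γ) : Prop :=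
  ∃ S c, 𝒯.IsCenter S c ∧ T = rightTranslate S c

theorem IsCenter.isShape {𝒯 : Tiling Γ} {S : Finset Γ} {c : Γ} (h : 𝒯.IsCenter S c) :
    𝒯.IsShape S :=
  let ⟨C, hC, _⟩ := h
  ⟨C, hC⟩

/-- The finite alphabet consisting of the shapes and of an extra symbol `0`, here `none`. -/
abbrev Symbols (𝒯 : Tiling Γ) : Type _ := Option {S : Finset Γ // 𝒯.IsShape S}

open Classical in
/-- The point of the shift coding the tiling: `x_t = S` if `t` is a center for the shape `S`, and
`x_t = 0` if `t` is not a center. -/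
def coding (𝒯 : Tiling Γ) : Shift Γ 𝒯.Symbols := fun t =>
  if h : ∃ S, 𝒯.IsCenter S t then some ⟨h.choose, h.choose_spec.isShape⟩ else none

theorem coding_eq_some {𝒯 : Tiling Γ} {S : Finset Γ} {t : Γ} (h : 𝒯.IsCenter S t) :
    𝒯.coding t = some ⟨S, h.isShape⟩ := by
  have hex : ∃ S, 𝒯.IsCenter S t := ⟨S, h⟩
  have heq : hex.choose = S := by
    obtain ⟨C, hC, htC⟩ := h
    obtain ⟨C', hC', htC'⟩ := hex.choose_spec
    by_contra hne
    refine Set.disjoint_left.1 (𝒯.centers_disjoint _ hC' _ hC ?_) htC' htC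
    exact fun he => hne (congrArg Prod.fst he)
  unfold coding
  rw [dif_pos hex]
  exact congrArg some (Subtype.ext heq)

/-- The entropy of a tiling: the topological entropy of the right shift action on the orbit closure
of its coding. -/
def entropy (F : ℕ → Finset Γ) (𝒯 : Tiling Γ) : EReal :=
  topEntropy F (orbitClosure 𝒯.coding)

end Tiling

/-- For every `n` and every `(S, C) ∈ 𝒯 (n + 1)`, the shape `S` is a disjoint union
`⨆_j S_j g_j` of translates of shapes of `𝒯 n` such that `g_j c` is a center for `S_j` in `𝒯 n`
for all `c ∈ C` and all `j`; here `D` is the set of all pairs `(S_j, g_j)`. -/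
def IsTightlyNested (𝒯 : ℕ → Tiling Γ) : Prop :=
  ∀ n, ∀ p ∈ (𝒯 (n + 1)).pairs, ∃ D : Finset (Finset Γ × Γ),
    (∀ q ∈ D, (𝒯 n).IsShape q.1) ∧
    (∀ q ∈ D, rightTranslate q.1 q.2 ⊆ p.1) ∧
    (∀ s ∈ p.1, ∃! q, q ∈ D ∧ s ∈ rightTranslate q.1 q.2) ∧
    ∀ c ∈ p.2, ∀ q ∈ D, (𝒯 n).IsCenter q.1 (q.2 * c)

/-- A sequence of Følner tilings. -/
def IsFolnerTilingSeq (𝒯 : ℕ → Tiling Γ) : Prop :=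
  ∀ (F : Finset Γ) (δ : ℝ), 0 < δ → ∃ N, ∀ n ≥ N, ∀ S, (𝒯 n).IsShape S → IsInvariant F δ S

/-- `H` and `𝒯` are as required in the definition of property ID. -/
structure RealizesPropertyID (H : Subgroup Γ) (𝒯 : ℕ → Tiling Γ) : Prop where
  isCyclic : IsCyclic H
  infinite : Infinite H
  infinite_index : ¬ H.FiniteIndex
  tightlyNested : IsTightlyNested 𝒯
  folner : IsFolnerTilingSeq 𝒯
  syndetic : ∀ n, ∀ p ∈ (𝒯 n).pairs, IsSyndetic p.2
  entropy_tendsto : ∀ F : ℕ → Finset Γ, IsFolnerSeq F →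
    Tendsto (fun n => (𝒯 n).entropy F) atTop (𝓝 0)
  finset_subset_tile : ∀ F : Finset Γ, ∃ n T, (𝒯 n).IsTile T ∧ F ⊆ T
  thin : ∀ δ : ℝ, 0 < δ → ∃ n₀, ∀ n ≥ n₀, ∀ T, (𝒯 n).IsTile T →
    (((H : Set Γ) ∩ T).ncard : ℝ) ≤ δ * T.card
  covers : ∀ n, ∃ S : Finset Γ, ∃ H₀ : Subgroup Γ, H₀ ≤ H ∧ (𝒯 n).IsShape S ∧
    (∀ c ∈ H₀, (𝒯 n).IsCenter S c) ∧ ∀ h ∈ H, ∃ c ∈ H₀, h ∈ rightTranslate S c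

variable (Γ) in
/-- Property ID. -/
def HasPropertyID : Prop :=
  ∃ (H : Subgroup Γ) (𝒯 : ℕ → Tiling Γ), RealizesPropertyID H 𝒯

end Tilings

end PropID

end

/-!
Write `H = ⟨a⟩` and build a decreasing sequence of normal subgroups `Nₙ` of finite index, each with
an almost invariant transversal `Fₙ` containing `1`. If all tiles were translates of `Fₙ` by the
elements of `Nₙ`, the tiling would be periodic, but `H` would not be covered by the tiles with
centers in a subgroup of `H`. One therefore adds a second, special shape `Fₙ Zₙ`, where `Zₙ ⊆ Nₙ` is
finite, injects into `Γ / H`, and is such that the translates of `Fₙ Zₙ` by `H ∩ Nₙ` are disjoint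
and cover `H`.

To pass to the next level, take a deep normal subgroup `Δ ≤ Nₙ` of finite index and, by amenability
of `Γ`, an almost invariant transversal `D` of `Nₙ / Δ`; then put `Nₙ₊₁ = Δ` and `Fₙ₊₁ = Fₙ D`. The
special tiles of level `n` centered in a transversal `J` of `(H ∩ Nₙ) / Δ` have to lie in the new
special tile, which is achieved by changing at most a multiple of `|J|` of the elements of `D`. The
centralizer of the image `ā` of `a` in `Γ / Δ` contains `⟨ā⟩`, so `|⟨ā⟩|` times the number of
conjugates of `ā` is at most `[Γ : Δ]`; and since `a` has infinitely many conjugates, residual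
finiteness makes this number as large as desired for deep `Δ`. Thus `|J| ≤ |⟨ā⟩|` is negligible
compared to `[Nₙ : Δ]`: the changes do not spoil the invariance, and `H` is thin in the tiles.

All centers of level `n` lie in `Nₙ`, and a Følner set `E` contains about `|E| / [Γ : Nₙ]` elements
of each coset of `Nₙ`; this bounds the entropy by a constant multiple of `1 / [Γ : Nₙ]`.
-/

open scoped Pointwise

namespace PropID

section Invariance

variable {Γ : Type*} [Group Γ]

section Boundary

variable [DecidableEq Γ]

/-- The elements of `S` that left multiplication by some element of `E` moves out of `S`: the
left `E`-boundary of `S`, in terms of which `IsInvariant` reads `|∂S| ≤ δ|S|`. -/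
def boundary (E S : Finset Γ) : Finset Γ :=
  S.filter fun s => ∃ t ∈ E, t * s ∉ S

theorem mem_boundary {E S : Finset Γ} {s : Γ} :
    s ∈ boundary E S ↔ s ∈ S ∧ ∃ t ∈ E, t * s ∉ S :=
  Finset.mem_filter

theorem isInvariant_iff_card_boundary_le {E S : Finset Γ} {δ : ℝ} :
    IsInvariant E δ S ↔ ((boundary E S).card : ℝ) ≤ δ * S.card := by
  have hcompl : ((S : Set Γ) ∩ ⋂ t ∈ E, {s : Γ | t * s ∈ S}) =
      ((S.filter fun s => ¬ ∃ t ∈ E, t * s ∉ S : Finset Γ) : Set Γ) := by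
    ext s
    simp
  have hcard := Finset.card_filter_add_card_filter_not (s := S) (fun s => ∃ t ∈ E, t * s ∉ S)
  unfold IsInvariant boundary
  rw [hcompl, Set.ncard_coe_finset, ← hcard]
  push_cast
  constructor <;> intro h <;> linarith

theorem boundary_mono {E K : Finset Γ} (h : E ⊆ K) (S : Finset Γ) :
    boundary E S ⊆ boundary K S := fun s hs => by
  rw [mem_boundary] at hs ⊢
  exact ⟨hs.1, hs.2.imp fun t ht => ⟨h ht.1, ht.2⟩⟩

theorem mul_subset_union_mul_boundary (K S : Finset Γ) : K * S ⊆ S ∪ K * boundary K S := by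
  intro g hg
  obtain ⟨t, ht, s, hs, rfl⟩ := Finset.mem_mul.1 hg
  by_cases hts : t * s ∈ S
  · exact Finset.mem_union_left _ hts
  · exact Finset.mem_union_right _ (Finset.mul_mem_mul ht (mem_boundary.2 ⟨hs, t, ht, hts⟩))

theorem IsInvariant.card_mul_le {K S : Finset Γ} {δ : ℝ} (h : IsInvariant K δ S) :
    ((K * S).card : ℝ) ≤ (1 + K.card * δ) * S.card := by
  rw [isInvariant_iff_card_boundary_le] at h
  have hcard : (K * S).card ≤ S.card + K.card * (boundary K S).card :=
    (Finset.card_le_card (mul_subset_union_mul_boundary K S)).trans <|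
      (Finset.card_union_le _ _).trans <| Nat.add_le_add_left Finset.card_mul_le _
  calc ((K * S).card : ℝ)
      ≤ S.card + K.card * (boundary K S).card := by exact_mod_cast hcard
    _ ≤ S.card + K.card * (δ * S.card) := by gcongr
    _ = (1 + K.card * δ) * S.card := by ring

theorem IsFolnerSeq.eventually_card_mul_le {F : ℕ → Finset Γ} (hF : IsFolnerSeq F)
    (K : Finset Γ) : ∀ᶠ n in atTop, (K * F n).card ≤ 2 * (F n).card := by
  obtain ⟨N, hN⟩ := hF.2 K (1 / (K.card + 1)) (by positivity)
  filter_upwards [eventually_ge_atTop N] with n hn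
  have hle : (1 : ℝ) + K.card * (1 / (K.card + 1)) ≤ 2 := by
    have : (K.card : ℝ) * (1 / (K.card + 1)) ≤ 1 := by
      rw [mul_one_div, div_le_one (by positivity)]
      linarith
    linarith
  have := (hN n hn).card_mul_le.trans (mul_le_mul_of_nonneg_right hle (Nat.cast_nonneg _))
  exact_mod_cast this

end Boundary

theorem IsInvariant.mono {E K S : Finset Γ} {δ ε : ℝ} (h : IsInvariant K δ S) (hEK : E ⊆ K)
    (hδ : δ ≤ ε) : IsInvariant E ε S := by
  classical
  rw [isInvariant_iff_card_boundary_le] at h ⊢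
  calc ((boundary E S).card : ℝ)
      ≤ (boundary K S).card := by exact_mod_cast Finset.card_le_card (boundary_mono hEK S)
    _ ≤ δ * S.card := h
    _ ≤ ε * S.card := by gcongr

theorem IsInvariant.card_le {K S : Finset Γ} {δ : ℝ} (h : IsInvariant K δ S) (hS : S.Nonempty)
    (hδ : δ < 1) : K.card ≤ S.card := by
  classical
  rw [isInvariant_iff_card_boundary_le] at h
  have hlt : (boundary K S).card < S.card := by
    have hpos : (0 : ℝ) < S.card := by exact_mod_cast hS.card_pos
    exact_mod_cast h.trans_lt (by nlinarith : δ * (S.card : ℝ) < S.card)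
  obtain ⟨s, hs, hs'⟩ := Finset.exists_mem_notMem_of_card_lt_card hlt
  refine Finset.card_le_card_of_injOn (fun t => t * s) (fun t ht => ?_) fun _ _ _ _ =>
    mul_right_cancel
  by_contra hts
  exact hs' (mem_boundary.2 ⟨hs, t, ht, hts⟩)

theorem IsFolnerSeq.tendsto_card [Infinite Γ] {F : ℕ → Finset Γ} (hF : IsFolnerSeq F) :
    Tendsto (fun n => (F n).card) atTop atTop := by
  refine tendsto_atTop.2 fun b => ?_
  obtain ⟨K, rfl⟩ := Infinite.exists_subset_card_eq Γ b
  obtain ⟨N, hN⟩ := hF.2 K (1 / 2) (by norm_num)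
  filter_upwards [eventually_ge_atTop N] with n hn
  exact (hN n hn).card_le (hF.1 n) (by norm_num)

end Invariance

section Cosets

variable {Γ : Type*} [Group Γ] [DecidableEq Γ] {N : Subgroup Γ} [N.Normal]

theorem card_mul_of_injOn_mk {F W : Finset Γ} (hF : Set.InjOn (QuotientGroup.mk (s := N)) F)
    (u : Γ ⧸ N) (hW : ∀ w ∈ W, (w : Γ ⧸ N) = u) : (F * W).card = F.card * W.card := by
  rw [Finset.card_mul_iff]
  rintro ⟨f, w⟩ ⟨hf, hw⟩ ⟨f', w'⟩ ⟨hf', hw'⟩ (heq : f * w = f' * w')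
  have hff' : f = f' := hF hf hf' <| by
    have := congrArg (QuotientGroup.mk (s := N)) heq
    rwa [QuotientGroup.mk_mul, QuotientGroup.mk_mul, hW w hw, hW w' hw', mul_left_inj] at this
  subst hff'
  rw [mul_left_cancel heq]

end Cosets

section Patterns

variable {Γ A : Type*}

theorem compactSpace_shift [Finite A] : CompactSpace (Shift Γ A) :=
  @Pi.compactSpace Γ (fun _ => A) (fun _ => ⊥) fun _ => @Finite.compactSpace A ⊥ _

theorem exists_cylinder_subset {V : Set (Shift Γ A)} (hV : IsOpen V) {y : Shift Γ A} (hy : y ∈ V) :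
    ∃ E : Finset Γ, ∀ z : Shift Γ A, (∀ e ∈ E, z e = y e) → z ∈ V := by
  let _ : TopologicalSpace A := ⊥
  obtain ⟨E, u, hu, hsub⟩ := (isOpen_pi_iff (A := fun _ : Γ => A)).1 hV y hy
  refine ⟨E, fun z hz => hsub fun e he => ?_⟩
  rw [hz e he]
  exact (hu e he).2

theorem isOpen_cylinder (E : Finset Γ) (y : Shift Γ A) :
    IsOpen {z : Shift Γ A | ∀ e ∈ E, z e = y e} := by
  let _ : TopologicalSpace A := ⊥
  have : DiscreteTopology A := ⟨rfl⟩
  exact isOpen_set_pi (A := fun _ : Γ => A) (s := fun e => {y e}) E.finite_toSet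
    fun _ _ => isOpen_discrete _

theorem exists_window [Finite A] {X : Set (Shift Γ A)} (hX : IsClosed X) {𝒰 : Set (Set X)}
    (h𝒰 : IsFiniteOpenCover 𝒰) :
    ∃ E : Finset Γ, ∀ y : X, ∃ U ∈ 𝒰, ∀ z : X, (∀ e ∈ E, z.1 e = y.1 e) → z ∈ U := by
  classical
  have := compactSpace_shift (Γ := Γ) (A := A)
  have : CompactSpace X := isCompact_iff_compactSpace.1 hX.isCompact
  have hlocal : ∀ y : X, ∃ E : Finset Γ, ∃ U ∈ 𝒰,
      ∀ z : X, (∀ e ∈ E, z.1 e = y.1 e) → z ∈ U := by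
    intro y
    obtain ⟨U, hU, hyU⟩ : y ∈ ⋃₀ 𝒰 := h𝒰.2.2 ▸ Set.mem_univ y
    obtain ⟨V, hV, rfl⟩ := isOpen_induced_iff.1 (h𝒰.2.1 U hU)
    obtain ⟨E, hE⟩ := exists_cylinder_subset hV hyU
    exact ⟨E, _, hU, fun z hz => hE z.1 hz⟩
  choose E U hU hEU using hlocal
  obtain ⟨t, -, ht⟩ := (isCompact_univ (X := X)).elim_nhds_subcover
    (fun y => {z : X | ∀ e ∈ E y, z.1 e = y.1 e})
    fun y _ => ((isOpen_cylinder (E y) y.1).preimage continuous_subtype_val).mem_nhds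
      fun _ _ => rfl
  refine ⟨t.biUnion E, fun y => ?_⟩
  obtain ⟨w, hw, hyw⟩ := Set.mem_iUnion₂.1 (ht (Set.mem_univ y))
  refine ⟨U w, hU w, fun z hz => hEU w z fun e he => ?_⟩
  rw [hz e (Finset.mem_biUnion.2 ⟨w, hw, he⟩), hyw e he]

/-- The patterns over the finite window `W` that occur in the configurations of `X`. -/
def patterns (W : Finset Γ) (X : Set (Shift Γ A)) : Set (W → A) :=
  (fun y t => y t) '' X

theorem patterns_closure (W : Finset Γ) (X : Set (Shift Γ A)) :
    patterns W (closure X) = patterns W X := by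
  refine (Set.image_mono subset_closure).antisymm' ?_
  rintro _ ⟨y, hy, rfl⟩
  obtain ⟨z, hz, hzX⟩ := mem_closure_iff.1 hy _ (isOpen_cylinder W y) fun _ _ => rfl
  exact ⟨z, hzX, funext fun t => hz t t.2⟩

theorem ncard_pi_subset_singleton_le {W : Type*} [Finite W] [Finite A] (o : A) (S : Set W) :
    {p : W → A | ∀ t ∉ S, p t = o}.ncard ≤ Nat.card A ^ S.ncard := by
  rw [← Nat.card_coe_set_eq, ← Nat.card_coe_set_eq, ← Nat.card_fun]
  refine Nat.card_le_card_of_injective (fun p (t : S) => p.1 t) fun p q hpq => ?_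
  refine Subtype.ext <| funext fun t => ?_
  by_cases ht : t ∈ S
  · exact congrFun hpq ⟨t, ht⟩
  · rw [p.2 t ht, q.2 t ht]

end Patterns

section Entropy

theorem coverNumber_le_ncard_range {X ι : Type*} {𝒰 : Set (Set X)} (f : X → ι)
    (hfin : (Set.range f).Finite) (hf : ∀ x, ∃ U ∈ 𝒰, ∀ y, f y = f x → y ∈ U) :
    coverNumber 𝒰 ≤ (Set.range f).ncard := by
  classical
  choose U hU hfU using hf
  have := hfin.fintype
  let V : Set.range f → Set X := fun i => U i.2.choose
  have hcover : coverNumber 𝒰 ≤ (Finset.univ.image V).card := by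
    refine Nat.sInf_le ⟨Finset.univ.image V, ?_, ?_, rfl⟩
    · rintro W hW
      obtain ⟨i, -, rfl⟩ := Finset.mem_image.1 (Finset.mem_coe.1 hW)
      exact hU _
    · refine Set.eq_univ_of_forall fun x => ?_
      have hx : f x ∈ Set.range f := ⟨x, rfl⟩
      exact ⟨V ⟨f x, hx⟩, Finset.mem_coe.2 (Finset.mem_image_of_mem _ (Finset.mem_univ _)),
        hfU _ x hx.choose_spec.symm⟩
  refine hcover.trans (Finset.card_image_le.trans_eq ?_)
  rw [Finset.card_univ, ← Nat.card_eq_fintype_card, Nat.card_coe_set_eq]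

variable {Γ A : Type*} [Group Γ]

theorem topEntropy_nonneg {X : Type*} [TopologicalSpace X] [MulAction Γ X] (F : ℕ → Finset Γ) :
    0 ≤ topEntropy F X := by
  have htrivial : IsFiniteOpenCover ({Set.univ} : Set (Set X)) :=
    ⟨Set.finite_singleton _, by simp, by simp⟩
  refine le_trans ?_ (le_iSup₂ (f := fun (𝒰 : Set (Set X)) (_ : IsFiniteOpenCover 𝒰) =>
    limsup (fun n => ((Real.log (coverNumber (joinCover (F n) 𝒰)) / (F n).card : ℝ) : EReal))
      atTop) _ htrivial)
  refine le_limsup_of_frequently_le (Eventually.frequently (Eventually.of_forall fun n => ?_))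
  exact EReal.coe_nonneg.2 (div_nonneg (Real.log_natCast_nonneg _) (Nat.cast_nonneg _))

theorem topEntropy_le_of_eventually_log_le [Infinite Γ] {X : Type*} [TopologicalSpace X]
    [MulAction Γ X] {F : ℕ → Finset Γ} (hF : IsFolnerSeq F) {b : ℝ}
    (h : ∀ 𝒰 : Set (Set X), IsFiniteOpenCover 𝒰 → ∃ C : ℝ, ∀ᶠ n in atTop,
      Real.log (coverNumber (joinCover (F n) 𝒰)) ≤ C + b * (F n).card) :
    topEntropy F X ≤ (b : EReal) := by
  classical
  refine iSup₂_le fun 𝒰 h𝒰 => ?_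
  obtain ⟨C, hC⟩ := h 𝒰 h𝒰
  have hlim : Tendsto (fun n => C / ((F n).card : ℝ) + b) atTop (𝓝 b) := by
    have hzero : Tendsto (fun n => C / ((F n).card : ℝ)) atTop (𝓝 0) :=
      tendsto_const_nhds.div_atTop (tendsto_natCast_atTop_atTop.comp hF.tendsto_card)
    simpa only [zero_add] using hzero.add_const b
  rw [← ((continuous_coe_real_ereal.tendsto b).comp hlim).limsup_eq]
  refine limsup_le_limsup ?_
  filter_upwards [hC] with n hn
  have hpos : (0 : ℝ) < (F n).card := by exact_mod_cast (hF.1 n).card_pos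
  refine EReal.coe_le_coe_iff.2 (?_ : _ / _ ≤ C / ((F n).card : ℝ) + b)
  rwa [div_add' _ _ _ hpos.ne', div_le_div_iff_of_pos_right hpos]

theorem exists_mem_joinCover_of_window [DecidableEq Γ] {X : SubMulAction Γ (Shift Γ A)}
    {𝒰 : Set (Set X)} {E : Finset Γ}
    (hE : ∀ y : X, ∃ U ∈ 𝒰, ∀ z : X, (∀ e ∈ E, z.1 e = y.1 e) → z ∈ U)
    (F : Finset Γ) (y : X) :
    ∃ V ∈ joinCover F 𝒰, ∀ z : X, (∀ t ∈ E * F, z.1 t = y.1 t) → z ∈ V := by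
  choose U hU hEU using fun s : Γ => hE (s • y)
  refine ⟨_, ⟨U, fun s _ => hU s, rfl⟩, fun z hz => Set.mem_iInter₂.2 fun s hs => ?_⟩
  exact hEU s (s • z) fun e he => hz (e * s) (Finset.mul_mem_mul he hs)

theorem coverNumber_joinCover_le_ncard_patterns [DecidableEq Γ] [Finite A]
    {X : SubMulAction Γ (Shift Γ A)} {𝒰 : Set (Set X)} {E : Finset Γ}
    (hE : ∀ y : X, ∃ U ∈ 𝒰, ∀ z : X, (∀ e ∈ E, z.1 e = y.1 e) → z ∈ U) (F : Finset Γ) :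
    coverNumber (joinCover F 𝒰) ≤ (patterns (E * F) (X : Set (Shift Γ A))).ncard := by
  have hrange : patterns (E * F) (X : Set (Shift Γ A)) =
      Set.range fun (y : X) (t : (E * F : Finset Γ)) => y.1 t := Set.image_eq_range _ _
  rw [hrange]
  refine coverNumber_le_ncard_range _ (Set.toFinite _) fun y => ?_
  obtain ⟨V, hV, hyV⟩ := exists_mem_joinCover_of_window hE F y
  exact ⟨V, hV, fun z hz => hyV z fun t ht => congrFun hz ⟨t, ht⟩⟩

variable {N : Subgroup Γ} [N.Normal] {x : Shift Γ A} {o : A}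

theorem patterns_orbitClosure_subset (hx : ∀ t, x t ≠ o → t ∈ N) (W : Finset Γ) :
    patterns W (orbitClosure x : Set (Shift Γ A)) ⊆
      ⋃ u : Γ ⧸ N, {p | ∀ t ∉ {t : W | ((t : Γ) : Γ ⧸ N) = u}, p t = o} := by
  rw [show (orbitClosure x : Set (Shift Γ A)) = closure (MulAction.orbit Γ x) from rfl,
    patterns_closure]
  rintro _ ⟨_, ⟨g, rfl⟩, rfl⟩
  refine Set.mem_iUnion.2 ⟨(g⁻¹ : Γ), fun t ht => ?_⟩
  by_contra hne
  have htg : ((t * g : Γ) : Γ ⧸ N) = 1 := (QuotientGroup.eq_one_iff _).2 (hx _ hne)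
  rw [QuotientGroup.mk_mul] at htg
  exact ht (eq_inv_of_mul_eq_one_left htg)

theorem ncard_patterns_orbitClosure_le [Finite A] [N.FiniteIndex] [DecidableEq (Γ ⧸ N)]
    (hx : ∀ t, x t ≠ o → t ∈ N) {W : Finset Γ} {m : ℕ}
    (hm : ∀ u : Γ ⧸ N, (W.filter fun t : Γ => (t : Γ ⧸ N) = u).card ≤ m) :
    (patterns W (orbitClosure x : Set (Shift Γ A))).ncard ≤ N.index * Nat.card A ^ m := by
  have := Fintype.ofFinite (Γ ⧸ N)
  have : Nonempty A := ⟨o⟩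
  have hcard : ∀ u : Γ ⧸ N, {t : W | ((t : Γ) : Γ ⧸ N) = u}.ncard ≤ m := fun u => by
    refine le_trans (le_of_eq ?_) (hm u)
    rw [← Set.ncard_image_of_injective _ Subtype.val_injective, ← Set.ncard_coe_finset]
    congr 1
    ext t
    simp [and_comm]
  calc (patterns W (orbitClosure x : Set (Shift Γ A))).ncard
      ≤ (⋃ u : Γ ⧸ N, {p : W → A | ∀ t ∉ {t : W | ((t : Γ) : Γ ⧸ N) = u}, p t = o}).ncard :=
        Set.ncard_le_ncard (patterns_orbitClosure_subset hx W)
    _ ≤ ∑ _u : Γ ⧸ N, Nat.card A ^ m :=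
        (Set.ncard_iUnion_le_of_fintype _).trans <| Finset.sum_le_sum fun u _ =>
          (ncard_pi_subset_singleton_le o _).trans (Nat.pow_le_pow_right Nat.card_pos (hcard u))
    _ = N.index * Nat.card A ^ m := by
        rw [Finset.sum_const, Finset.card_univ, smul_eq_mul, Subgroup.index_eq_card,
          Nat.card_eq_fintype_card (α := Γ ⧸ N)]

theorem log_coverNumber_joinCover_le [DecidableEq Γ] [Finite A] [N.FiniteIndex]
    {T : Finset Γ} (hT : T.Nonempty) (hTN : Set.InjOn (QuotientGroup.mk (s := N)) T)
    (hx : ∀ t, x t ≠ o → t ∈ N) {𝒰 : Set (Set (orbitClosure x))} {E F : Finset Γ}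
    (hE : ∀ y : orbitClosure x, ∃ U ∈ 𝒰, ∀ z : orbitClosure x,
      (∀ e ∈ E, z.1 e = y.1 e) → z ∈ U)
    (hF : (T * E * F).card ≤ 2 * F.card) :
    Real.log (coverNumber (joinCover F 𝒰)) ≤
      Real.log N.index + 2 * Real.log (Nat.card A) / T.card * F.card := by
  classical
  have : Nonempty A := ⟨o⟩
  have hN : (N.index : ℝ) ≠ 0 := Nat.cast_ne_zero.2 Subgroup.FiniteIndex.index_ne_zero
  have hA : (Nat.card A : ℝ) ≠ 0 := Nat.cast_ne_zero.2 Nat.card_pos.ne'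
  have hcoset : ∀ u : Γ ⧸ N,
      ((E * F).filter fun t : Γ => (t : Γ ⧸ N) = u).card ≤ 2 * F.card / T.card := fun u => by
    rw [Nat.le_div_iff_mul_le hT.card_pos, mul_comm,
      ← card_mul_of_injOn_mk hTN u fun t ht => (Finset.mem_filter.1 ht).2]
    refine (Finset.card_le_card ?_).trans hF
    rw [mul_assoc]
    exact Finset.mul_subset_mul_left (Finset.filter_subset _ _)
  have hcover := (coverNumber_joinCover_le_ncard_patterns hE F).trans
    (ncard_patterns_orbitClosure_le hx hcoset)
  calc Real.log (coverNumber (joinCover F 𝒰))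
      ≤ Real.log (N.index * Nat.card A ^ (2 * F.card / T.card) : ℕ) := by
        rcases Nat.eq_zero_or_pos (coverNumber (joinCover F 𝒰)) with h0 | hpos
        · rw [h0, Nat.cast_zero, Real.log_zero]
          exact Real.log_natCast_nonneg _
        · exact Real.log_le_log (by exact_mod_cast hpos) (by exact_mod_cast hcover)
    _ = Real.log N.index + (2 * F.card / T.card : ℕ) * Real.log (Nat.card A) := by
        rw [Nat.cast_mul, Nat.cast_pow, Real.log_mul hN (pow_ne_zero _ hA), Real.log_pow]
    _ ≤ Real.log N.index + (2 * F.card : ℕ) / T.card * Real.log (Nat.card A) := by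
        gcongr
        exact Nat.cast_div_le
    _ = Real.log N.index + 2 * Real.log (Nat.card A) / T.card * F.card := by
        push_cast
        ring

theorem topEntropy_orbitClosure_le [Infinite Γ] [Finite A] [N.FiniteIndex] {T : Finset Γ}
    (hT : T.Nonempty) (hTN : Set.InjOn (QuotientGroup.mk (s := N)) T)
    (hx : ∀ t, x t ≠ o → t ∈ N) {F : ℕ → Finset Γ} (hF : IsFolnerSeq F) :
    topEntropy F (orbitClosure x) ≤ ((2 * Real.log (Nat.card A) / T.card : ℝ) : EReal) := by
  classical
  refine topEntropy_le_of_eventually_log_le hF fun 𝒰 h𝒰 => ?_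
  obtain ⟨E, hE⟩ := exists_window (X := (orbitClosure x : Set (Shift Γ A))) isClosed_closure h𝒰
  refine ⟨Real.log N.index, ?_⟩
  filter_upwards [hF.eventually_card_mul_le (T * E)] with n hn
  exact log_coverNumber_joinCover_le hT hTN hx hE hn

end Entropy

section Substitution

variable {Γ : Type*} [Group Γ]

theorem mem_rightTranslate {S : Finset Γ} {c g : Γ} :
    g ∈ rightTranslate S c ↔ g * c⁻¹ ∈ S := by
  simp only [rightTranslate, Finset.mem_map, mulRightEmbedding_apply]
  constructor
  · rintro ⟨s, hs, rfl⟩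
    simpa using hs
  · exact fun h => ⟨_, h, by simp⟩

theorem mul_mem_rightTranslate {S : Finset Γ} {c s : Γ} (hs : s ∈ S) :
    s * c ∈ rightTranslate S c :=
  mem_rightTranslate.2 (by simpa using hs)

theorem rightTranslate_mul (S : Finset Γ) (g c : Γ) :
    rightTranslate S (g * c) = rightTranslate (rightTranslate S g) c := by
  ext x
  simp [mem_rightTranslate, mul_assoc]

theorem rightTranslate_mono {S T : Finset Γ} (h : S ⊆ T) (c : Γ) :
    rightTranslate S c ⊆ rightTranslate T c := fun _ hx =>
  mem_rightTranslate.2 (h (mem_rightTranslate.1 hx))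

theorem rightTranslate_one (S : Finset Γ) : rightTranslate S 1 = S := by
  ext x
  simp [mem_rightTranslate]

variable (Γ) in
/-- Shapes labelled by `ι` at every level, with a partition of each shape into right translates
`S_b g` of the shapes one level below, recorded as the finite set of the pairs `(b, g)`. The shapes
with label `root` increase and exhaust the group, so that refining them down to a fixed level
yields a tiling. -/
structure Substitution (ι : Type*) where
  root : ι
  shape : ℕ → ι → Finset Γ
  rule : ℕ → ι → Finset (ι × Γ)
  rule_subset : ∀ n b, ∀ q ∈ rule n b, rightTranslate (shape n q.1) q.2 ⊆ shape (n + 1) b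
  rule_unique : ∀ n b, ∀ s ∈ shape (n + 1) b,
    ∃! q, q ∈ rule n b ∧ s ∈ rightTranslate (shape n q.1) q.2
  one_mem_shape : ∀ n b, 1 ∈ shape n b
  root_mem_rule : ∀ n, (root, 1) ∈ rule n root
  rule_occurs : ∀ n b b', ∃ g, (b', g) ∈ rule n b
  exhausts : ∀ g, ∃ n, g ∈ shape n root

namespace Substitution

variable {ι : Type*} (σ : Substitution Γ ι)

/-- The tile of level `n` with label `p.1` and center `p.2`. -/
def tile (n : ℕ) (p : ι × Γ) : Finset Γ := rightTranslate (σ.shape n p.1) p.2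

/-- The labelled centers of the partition of `σ.shape (n + k) σ.root` into tiles of level `n`. -/
def pieces : ℕ → ℕ → Set (ι × Γ)
  | 0, _ => {(σ.root, 1)}
  | k + 1, n => {p | ∃ q ∈ pieces k (n + 1), ∃ r ∈ σ.rule n q.1, p = (r.1, r.2 * q.2)}

theorem pieces_subset_succ (k n : ℕ) : σ.pieces k n ⊆ σ.pieces (k + 1) n := by
  induction k generalizing n with
  | zero =>
    rintro p rfl
    exact ⟨(σ.root, 1), rfl, (σ.root, 1), σ.root_mem_rule n, by simp⟩
  | succ k ih =>
    rintro p ⟨q, hq, r, hr, rfl⟩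
    exact ⟨q, ih _ hq, r, hr, rfl⟩

theorem pieces_mono (n : ℕ) : Monotone fun k => σ.pieces k n :=
  monotone_nat_of_le_succ fun k => σ.pieces_subset_succ k n

theorem tile_rule (n : ℕ) (q r : ι × Γ) :
    σ.tile n (r.1, r.2 * q.2) = rightTranslate (rightTranslate (σ.shape n r.1) r.2) q.2 :=
  rightTranslate_mul _ _ _

theorem tile_rule_subset {n : ℕ} {q r : ι × Γ} (hr : r ∈ σ.rule n q.1) :
    σ.tile n (r.1, r.2 * q.2) ⊆ σ.tile (n + 1) q := by
  rw [tile_rule]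
  exact rightTranslate_mono (σ.rule_subset n _ r hr) _

theorem exists_rule_of_mem_tile {n : ℕ} {q : ι × Γ} {g : Γ} (hg : g ∈ σ.tile (n + 1) q) :
    ∃ r ∈ σ.rule n q.1, g ∈ σ.tile n (r.1, r.2 * q.2) := by
  obtain ⟨r, ⟨hr, hgr⟩, -⟩ := σ.rule_unique n q.1 _ (mem_rightTranslate.1 hg)
  exact ⟨r, hr, by rw [tile_rule]; exact mem_rightTranslate.2 hgr⟩

theorem rule_eq_of_mem_tile {n : ℕ} {q r r' : ι × Γ} {g : Γ} (hr : r ∈ σ.rule n q.1)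
    (hr' : r' ∈ σ.rule n q.1) (hg : g ∈ σ.tile n (r.1, r.2 * q.2))
    (hg' : g ∈ σ.tile n (r'.1, r'.2 * q.2)) : r = r' := by
  have hgq := mem_rightTranslate.1 (σ.tile_rule_subset hr hg)
  rw [tile_rule] at hg hg'
  exact (σ.rule_unique n q.1 _ hgq).unique ⟨hr, mem_rightTranslate.1 hg⟩
    ⟨hr', mem_rightTranslate.1 hg'⟩

theorem tile_subset_of_mem_pieces {k n : ℕ} {p : ι × Γ} (hp : p ∈ σ.pieces k n) :
    σ.tile n p ⊆ σ.shape (n + k) σ.root := by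
  induction k generalizing n p with
  | zero =>
    rw [Set.mem_singleton_iff.1 hp]
    exact (rightTranslate_one _).subset
  | succ k ih =>
    obtain ⟨q, hq, r, hr, rfl⟩ := hp
    rw [show n + (k + 1) = n + 1 + k by omega]
    exact (σ.tile_rule_subset hr).trans (ih hq)

theorem exists_piece {k n : ℕ} {g : Γ} (hg : g ∈ σ.shape (n + k) σ.root) :
    ∃ p ∈ σ.pieces k n, g ∈ σ.tile n p := by
  induction k generalizing n with
  | zero => exact ⟨(σ.root, 1), rfl, (rightTranslate_one _).symm.subset hg⟩
  | succ k ih =>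
    rw [show n + (k + 1) = n + 1 + k by omega] at hg
    obtain ⟨q, hq, hgq⟩ := ih hg
    obtain ⟨r, hr, hgr⟩ := σ.exists_rule_of_mem_tile hgq
    exact ⟨_, ⟨q, hq, r, hr, rfl⟩, hgr⟩

theorem piece_unique {k n : ℕ} {g : Γ} {p p' : ι × Γ} (hp : p ∈ σ.pieces k n)
    (hp' : p' ∈ σ.pieces k n) (hg : g ∈ σ.tile n p) (hg' : g ∈ σ.tile n p') : p = p' := by
  induction k generalizing n p p' with
  | zero => rw [Set.mem_singleton_iff.1 hp, Set.mem_singleton_iff.1 hp']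
  | succ k ih =>
    obtain ⟨q, hq, r, hr, rfl⟩ := hp
    obtain ⟨q', hq', r', hr', rfl⟩ := hp'
    obtain rfl := ih hq hq' (σ.tile_rule_subset hr hg) (σ.tile_rule_subset hr' hg')
    rw [σ.rule_eq_of_mem_tile hr hr' hg hg']

theorem shape_mono : Monotone fun n => σ.shape n σ.root :=
  monotone_nat_of_le_succ fun n => by
    have h := σ.rule_subset n σ.root _ (σ.root_mem_rule n)
    rwa [rightTranslate_one] at h

/-- The labelled centers of the tiling of level `n`: those of all the partitions `pieces k n`, which
increase with `k`. -/
def level (n : ℕ) : Set (ι × Γ) := ⋃ k, σ.pieces k n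

theorem root_mem_level (n : ℕ) : (σ.root, 1) ∈ σ.level n := Set.mem_iUnion.2 ⟨0, rfl⟩

theorem mem_level_iff {n : ℕ} {p : ι × Γ} :
    p ∈ σ.level n ↔ ∃ q ∈ σ.level (n + 1), ∃ r ∈ σ.rule n q.1, p = (r.1, r.2 * q.2) := by
  constructor
  · intro hp
    obtain ⟨k, hk⟩ := Set.mem_iUnion.1 hp
    obtain ⟨q, hq, r, hr, rfl⟩ := σ.pieces_subset_succ k n hk
    exact ⟨q, Set.mem_iUnion.2 ⟨k, hq⟩, r, hr, rfl⟩
  · rintro ⟨q, hq, r, hr, rfl⟩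
    obtain ⟨k, hk⟩ := Set.mem_iUnion.1 hq
    exact Set.mem_iUnion.2 ⟨k + 1, q, hk, r, hr, rfl⟩

theorem existsUnique_mem_level (n : ℕ) (g : Γ) : ∃! p, p ∈ σ.level n ∧ g ∈ σ.tile n p := by
  obtain ⟨m, hm⟩ := σ.exhausts g
  obtain ⟨p, hp, hgp⟩ := σ.exists_piece (n := n) (σ.shape_mono (Nat.le_add_left m n) hm)
  refine ⟨p, ⟨Set.mem_iUnion.2 ⟨m, hp⟩, hgp⟩, ?_⟩
  rintro p' ⟨hp', hgq⟩
  obtain ⟨k, hk⟩ := Set.mem_iUnion.1 hp'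
  exact σ.piece_unique (σ.pieces_mono n (le_max_left k m) hk)
    (σ.pieces_mono n (le_max_right k m) hp) hgq hgp

/-- The centers of the tiles of level `n` with label `b`. -/
def centers (n : ℕ) (b : ι) : Set Γ := {c | (b, c) ∈ σ.level n}

theorem centers_disjoint (n : ℕ) {b b' : ι} (h : b ≠ b') :
    Disjoint (σ.centers n b) (σ.centers n b') := by
  refine Set.disjoint_left.2 fun c hc hc' => h ?_
  have hmem : ∀ b, c ∈ σ.tile n (b, c) := fun b => by
    rw [tile, mem_rightTranslate]
    simpa using σ.one_mem_shape n b
  exact congrArg Prod.fst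
    ((σ.existsUnique_mem_level n c).unique ⟨hc, hmem b⟩ ⟨hc', hmem b'⟩)

theorem isSyndetic_centers [Finite ι] (n : ℕ) (b : ι) : IsSyndetic (σ.centers n b) := by
  classical
  have := Fintype.ofFinite ι
  choose r hr using σ.rule_occurs n
  refine ⟨Finset.univ.biUnion fun b' => (σ.shape (n + 1) b').image fun s => s * (r b' b)⁻¹,
    fun g => ?_⟩
  obtain ⟨⟨b', c⟩, ⟨hp, hg⟩, -⟩ := σ.existsUnique_mem_level (n + 1) g
  refine ⟨g * c⁻¹ * (r b' b)⁻¹, Finset.mem_biUnion.2 ⟨b', Finset.mem_univ _,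
    Finset.mem_image_of_mem _ (mem_rightTranslate.1 hg)⟩, r b' b * c,
    σ.mem_level_iff.2 ⟨(b', c), hp, (b, r b' b), hr b' b, rfl⟩, by simp [mul_assoc]⟩

variable [Fintype ι]

open Classical in
/-- The tiling by the tiles of level `n`, whose pairs are indexed by the labels. -/
noncomputable def tiling (n : ℕ) : Tiling Γ where
  pairs := Finset.univ.image fun b => (σ.shape n b, σ.centers n b)
  shape_nonempty := by
    intro p hp
    obtain ⟨b, -, rfl⟩ := Finset.mem_image.1 hp
    exact ⟨1, σ.one_mem_shape n b⟩
  existsUnique_tile := by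
    intro g
    obtain ⟨⟨b, c⟩, ⟨hp, hg⟩, huniq⟩ := σ.existsUnique_mem_level n g
    refine ⟨((σ.shape n b, σ.centers n b), c),
      ⟨Finset.mem_image_of_mem _ (Finset.mem_univ b), hp, hg⟩, ?_⟩
    rintro ⟨p, c'⟩ ⟨hp', hc', hg'⟩
    obtain ⟨b', -, rfl⟩ := Finset.mem_image.1 hp'
    have h := huniq (b', c') ⟨hc', hg'⟩
    simp only [Prod.mk.injEq] at h
    rw [h.1, h.2]
  centers_disjoint := by
    intro p hp q hq hne
    obtain ⟨b, -, rfl⟩ := Finset.mem_image.1 hp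
    obtain ⟨b', -, rfl⟩ := Finset.mem_image.1 hq
    exact σ.centers_disjoint n fun h => hne (by rw [h])

theorem mem_pairs {n : ℕ} {p : Finset Γ × Set Γ} :
    p ∈ (σ.tiling n).pairs ↔ ∃ b, p = (σ.shape n b, σ.centers n b) := by
  simp only [tiling, Finset.mem_image, Finset.mem_univ, true_and, eq_comm]

theorem isShape_iff {n : ℕ} {S : Finset Γ} :
    (σ.tiling n).IsShape S ↔ ∃ b, S = σ.shape n b := by
  simp only [Tiling.IsShape, mem_pairs, Prod.mk.injEq]
  exact ⟨fun ⟨_, b, h, _⟩ => ⟨b, h⟩, fun ⟨b, h⟩ => ⟨_, b, h, rfl⟩⟩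

theorem isCenter_iff {n : ℕ} {S : Finset Γ} {c : Γ} :
    (σ.tiling n).IsCenter S c ↔ ∃ b, S = σ.shape n b ∧ (b, c) ∈ σ.level n := by
  simp only [Tiling.IsCenter, mem_pairs, Prod.mk.injEq]
  exact ⟨fun ⟨_, ⟨b, h, h'⟩, hc⟩ => ⟨b, h, by subst h'; exact hc⟩,
    fun ⟨b, h, hc⟩ => ⟨_, ⟨b, h, rfl⟩, hc⟩⟩

theorem isTightlyNested : IsTightlyNested σ.tiling := by
  classical
  intro n p hp
  obtain ⟨b, rfl⟩ := σ.mem_pairs.1 hp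
  refine ⟨(σ.rule n b).image fun q => (σ.shape n q.1, q.2), ?_, ?_, ?_, ?_⟩
  · intro q hq
    obtain ⟨r, -, rfl⟩ := Finset.mem_image.1 hq
    exact σ.isShape_iff.2 ⟨_, rfl⟩
  · intro q hq
    obtain ⟨r, hr, rfl⟩ := Finset.mem_image.1 hq
    exact σ.rule_subset n b r hr
  · intro s hs
    obtain ⟨r, ⟨hr, hsr⟩, huniq⟩ := σ.rule_unique n b s hs
    refine ⟨_, ⟨Finset.mem_image_of_mem _ hr, hsr⟩, ?_⟩
    rintro q ⟨hq, hsq⟩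
    obtain ⟨r', hr', rfl⟩ := Finset.mem_image.1 hq
    rw [huniq r' ⟨hr', hsq⟩]
  · intro c hc q hq
    obtain ⟨r, hr, rfl⟩ := Finset.mem_image.1 hq
    exact σ.isCenter_iff.2 ⟨r.1, rfl, σ.mem_level_iff.2 ⟨(b, c), hc, r, hr, rfl⟩⟩

theorem finset_subset_tile (F : Finset Γ) : ∃ n T, (σ.tiling n).IsTile T ∧ F ⊆ T := by
  choose m hm using σ.exhausts
  refine ⟨F.sup m, _, ⟨_, 1, σ.isCenter_iff.2 ⟨σ.root, rfl, σ.root_mem_level _⟩, rfl⟩,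
    fun g hg => ?_⟩
  rw [rightTranslate_one]
  exact σ.shape_mono (Finset.le_sup hg) (hm g)

theorem exists_surjective_symbols (n : ℕ) :
    ∃ f : Option ι → (σ.tiling n).Symbols, Function.Surjective f := by
  refine ⟨Option.map fun b => ⟨σ.shape n b, σ.isShape_iff.2 ⟨b, rfl⟩⟩, ?_⟩
  rintro (_ | ⟨S, hS⟩)
  · exact ⟨none, rfl⟩
  · obtain ⟨b, rfl⟩ := σ.isShape_iff.1 hS
    exact ⟨some b, rfl⟩

theorem finite_symbols (n : ℕ) : Finite (σ.tiling n).Symbols :=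
  Finite.of_surjective _ (σ.exists_surjective_symbols n).choose_spec

theorem card_symbols_le (n : ℕ) : Nat.card (σ.tiling n).Symbols ≤ Fintype.card ι + 1 := by
  refine (Nat.card_le_card_of_surjective _ (σ.exists_surjective_symbols n).choose_spec).trans ?_
  rw [Nat.card_eq_fintype_card, Fintype.card_option]

theorem mem_level_of_coding_ne_none {n : ℕ} {t : Γ} (ht : (σ.tiling n).coding t ≠ none) :
    ∃ b, (b, t) ∈ σ.level n := by
  obtain ⟨S, hS⟩ : ∃ S, (σ.tiling n).IsCenter S t := by
    by_contra h
    exact ht (dif_neg h)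
  obtain ⟨b, -, hb⟩ := σ.isCenter_iff.1 hS
  exact ⟨b, hb⟩

theorem entropy_le [Infinite Γ] (n : ℕ) {N : Subgroup Γ} [N.Normal] [N.FiniteIndex]
    (hN : ∀ p ∈ σ.level n, p.2 ∈ N) {T : Finset Γ} (hT : T.Nonempty)
    (hTN : Set.InjOn (QuotientGroup.mk (s := N)) T) {F : ℕ → Finset Γ} (hF : IsFolnerSeq F) :
    (σ.tiling n).entropy F ≤
      ((2 * Real.log (Fintype.card ι + 1 : ℕ) / T.card : ℝ) : EReal) := by
  have := σ.finite_symbols n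
  have : Nonempty (σ.tiling n).Symbols := ⟨none⟩
  refine (topEntropy_orbitClosure_le (o := none) hT hTN (fun t ht => ?_) hF).trans ?_
  · exact (σ.mem_level_of_coding_ne_none ht).elim fun b hb => hN _ hb
  · have hpos : (0 : ℝ) < Nat.card (σ.tiling n).Symbols := by exact_mod_cast Nat.card_pos
    refine EReal.coe_le_coe_iff.2 ?_
    gcongr
    exact σ.card_symbols_le n

end Substitution

end Substitution

section Transversals

variable {Γ : Type*} [Group Γ] {N Δ : Subgroup Γ}

/-- `D ⊆ N` is a set of representatives of the left cosets `n Δ`, `n ∈ N`. The subgroup `Δ` is not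
required to lie in `N`. -/
structure IsTransversal (D : Finset Γ) (N Δ : Subgroup Γ) : Prop where
  subset : (D : Set Γ) ⊆ N
  injOn : Set.InjOn (QuotientGroup.mk (s := Δ)) D
  exists_inv_mul_mem : ∀ g ∈ N, ∃ d ∈ D, d⁻¹ * g ∈ Δ

theorem IsTransversal.card_eq {D : Finset Γ} (hD : IsTransversal D N Δ) :
    D.card = Δ.relIndex N := by
  let f : D → N ⧸ Δ.subgroupOf N := fun d => QuotientGroup.mk ⟨d, hD.subset d.2⟩
  have hf : Function.Bijective f := by
    refine ⟨fun d d' h => ?_, fun q => ?_⟩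
    · exact Subtype.ext <| hD.injOn d.2 d'.2 <| QuotientGroup.eq.2 <|
        Subgroup.mem_subgroupOf.1 (QuotientGroup.eq.1 h)
    · obtain ⟨g, rfl⟩ := QuotientGroup.mk_surjective q
      obtain ⟨d, hd, hdg⟩ := hD.exists_inv_mul_mem g g.2
      exact ⟨⟨d, hd⟩, QuotientGroup.eq.2 (Subgroup.mem_subgroupOf.2 hdg)⟩
  rw [Subgroup.relIndex, Subgroup.index_eq_card, ← Nat.card_eq_of_bijective f hf,
    Nat.card_eq_fintype_card, Fintype.card_coe]

theorem IsTransversal.mul [DecidableEq Γ] {M : Subgroup Γ} {F D : Finset Γ}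
    (hF : IsTransversal F M N) (hD : IsTransversal D N Δ) (hΔ : Δ ≤ N) (hN : N ≤ M) :
    IsTransversal (F * D) M Δ where
  subset := by
    rw [Finset.coe_mul]
    rintro _ ⟨f, hf, d, hd, rfl⟩
    exact M.mul_mem (hF.subset hf) (hN (hD.subset hd))
  injOn := by
    rw [Finset.coe_mul]
    rintro _ ⟨f, hf, d, hd, rfl⟩ _ ⟨f', hf', d', hd', rfl⟩ heq
    replace heq : d⁻¹ * (f⁻¹ * f' * d') ∈ Δ := by
      simpa only [mul_inv_rev, mul_assoc] using QuotientGroup.eq.1 heq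
    have hff' : f = f' := hF.injOn hf hf' <| QuotientGroup.eq.2 <|
      (N.mul_mem_cancel_right (hD.subset hd')).1
        ((N.mul_mem_cancel_left (N.inv_mem (hD.subset hd))).1 (hΔ heq))
    subst hff'
    rw [inv_mul_cancel, one_mul] at heq
    change f * d = f * d'
    rw [hD.injOn hd hd' (QuotientGroup.eq.2 heq)]
  exists_inv_mul_mem g hg := by
    obtain ⟨f, hf, hfg⟩ := hF.exists_inv_mul_mem g hg
    obtain ⟨d, hd, hdg⟩ := hD.exists_inv_mul_mem _ hfg
    exact ⟨f * d, Finset.mul_mem_mul hf hd, by rwa [mul_inv_rev, mul_assoc]⟩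

theorem exists_isTransversal_between [Δ.FiniteIndex] {P : Finset Γ} {S : Set Γ}
    (hPS : (P : Set Γ) ⊆ S) (hSN : S ⊆ N) (hS : ∀ g ∈ N, ∃ s ∈ S, s⁻¹ * g ∈ Δ)
    (hP : Set.InjOn (QuotientGroup.mk (s := Δ)) P) :
    ∃ D : Finset Γ, P ⊆ D ∧ (D : Set Γ) ⊆ S ∧ IsTransversal D N Δ := by
  obtain ⟨D, hPD, hDS, himage, hinj⟩ := hP.exists_subset_injOn_subset_range_eq hPS
  have hfin : D.Finite := Set.Finite.of_finite_image (Set.toFinite _) hinj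
  lift D to Finset Γ using hfin
  refine ⟨D, Finset.coe_subset.1 hPD, hDS, hDS.trans hSN, hinj, fun g hg => ?_⟩
  obtain ⟨s, hs, hsg⟩ := hS g hg
  obtain ⟨d, hd, hds⟩ : (s : Γ ⧸ Δ) ∈ QuotientGroup.mk '' (D : Set Γ) :=
    himage ▸ Set.mem_image_of_mem _ hs
  exact ⟨d, hd, QuotientGroup.eq.1 (hds.trans (QuotientGroup.eq.2 hsg))⟩

theorem exists_isTransversal_superset [Δ.FiniteIndex] {P : Finset Γ} (hPN : (P : Set Γ) ⊆ N)
    (hP : Set.InjOn (QuotientGroup.mk (s := Δ)) P) :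
    ∃ D : Finset Γ, P ⊆ D ∧ IsTransversal D N Δ := by
  obtain ⟨D, hPD, -, hD⟩ := exists_isTransversal_between hPN subset_rfl
    (fun g hg => ⟨g, hg, by rw [inv_mul_cancel]; exact Δ.one_mem⟩) hP
  exact ⟨D, hPD, hD⟩

variable [DecidableEq Γ]

theorem card_boundary_le_add_card_sdiff (E D D₀ : Finset Γ) :
    (boundary E D).card ≤
      (boundary E D₀).card + ((D \ D₀).card + E.card * (D₀ \ D).card) := by
  have hsub : boundary E D ⊆ boundary E D₀ ∪ (D \ D₀ ∪ E⁻¹ * (D₀ \ D)) := by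
    intro d hd
    obtain ⟨hdD, t, ht, htd⟩ := mem_boundary.1 hd
    simp only [Finset.mem_union, Finset.mem_sdiff, mem_boundary]
    by_cases hd₀ : d ∈ D₀
    · by_cases htd₀ : t * d ∈ D₀
      · exact Or.inr (Or.inr (Finset.mem_mul.2 ⟨t⁻¹, Finset.inv_mem_inv ht, t * d,
          Finset.mem_sdiff.2 ⟨htd₀, htd⟩, inv_mul_cancel_left t d⟩))
      · exact Or.inl ⟨hd₀, t, ht, htd₀⟩
    · exact Or.inr (Or.inl ⟨hdD, hd₀⟩)
  calc (boundary E D).card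
      ≤ (boundary E D₀).card + ((D \ D₀).card + (E⁻¹ * (D₀ \ D)).card) :=
        (Finset.card_le_card hsub).trans <| (Finset.card_union_le _ _).trans <|
          Nat.add_le_add_left (Finset.card_union_le _ _) _
    _ ≤ (boundary E D₀).card + ((D \ D₀).card + E.card * (D₀ \ D).card) := by
        gcongr
        exact Finset.card_mul_le.trans_eq (by rw [Finset.card_inv])

theorem IsTransversal.exists_superset_card_boundary_le [Δ.FiniteIndex] {D₀ P : Finset Γ}
    (hD₀ : IsTransversal D₀ N Δ) (hPN : (P : Set Γ) ⊆ N)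
    (hP : Set.InjOn (QuotientGroup.mk (s := Δ)) P) (E : Finset Γ) :
    ∃ D : Finset Γ, P ⊆ D ∧ IsTransversal D N Δ ∧
      (boundary E D).card ≤ (boundary E D₀).card + (1 + E.card) * P.card := by
  obtain ⟨D, hPD, hDS, hD⟩ := exists_isTransversal_between (S := ↑D₀ ∪ ↑P)
    Set.subset_union_right (Set.union_subset hD₀.subset hPN)
    (fun g hg => (hD₀.exists_inv_mul_mem g hg).imp fun d hd => ⟨Or.inl hd.1, hd.2⟩) hP
  refine ⟨D, hPD, hD, (card_boundary_le_add_card_sdiff E D D₀).trans ?_⟩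
  have hle : (D \ D₀).card ≤ P.card := Finset.card_le_card fun d hd => by
    rw [Finset.mem_sdiff] at hd
    exact (hDS hd.1).resolve_left hd.2
  have heq : (D₀ \ D).card = (D \ D₀).card :=
    Finset.card_sdiff_comm (hD₀.card_eq.trans hD.card_eq.symm)
  rw [heq, add_mul, one_mul]
  gcongr

end Transversals

section AlmostInvariantTransversals

variable {Γ G : Type*} [Group Γ] [Group G] [DecidableEq G]

theorem sum_card_filter_mul_mem [Fintype G] (φ : Γ →* G) (S : Finset Γ) (A : Finset G) :
    ∑ c : G, (S.filter fun σ => φ σ * c ∈ A).card = S.card * A.card := by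
  simp_rw [Finset.card_filter]
  rw [Finset.sum_comm, Finset.card_eq_sum_ones S, Finset.sum_mul]
  refine Finset.sum_congr rfl fun σ _ => ?_
  rw [← Finset.card_filter, one_mul]
  refine Finset.card_bij' (fun c _ => φ σ * c) (fun a _ => (φ σ)⁻¹ * a) ?_ ?_ ?_ ?_ <;> simp

theorem exists_card_filter_mul_mem_le [Finite G] (φ : Γ →* G) {S B : Finset Γ} {η : ℝ}
    (hS : S.Nonempty) (hB : (B.card : ℝ) ≤ η * S.card) {A : Finset G} (hA : A.Nonempty) :
    ∃ c : G, (S.filter fun σ => φ σ * c ∈ A).Nonempty ∧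
      ((B.filter fun σ => φ σ * c ∈ A).card : ℝ) ≤ η * (S.filter fun σ => φ σ * c ∈ A).card := by
  have := Fintype.ofFinite G
  by_contra! hcon
  have hle : ∀ c : G, η * (S.filter fun σ => φ σ * c ∈ A).card ≤
      (B.filter fun σ => φ σ * c ∈ A).card := by
    intro c
    rcases (S.filter fun σ => φ σ * c ∈ A).eq_empty_or_nonempty with hempty | hne
    · rw [hempty, Finset.card_empty, Nat.cast_zero, mul_zero]
      exact Nat.cast_nonneg _
    · exact (hcon c hne).le
  obtain ⟨σ, hσ⟩ := hS
  obtain ⟨a, ha⟩ := hA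
  have hne : (S.filter fun τ => φ τ * ((φ σ)⁻¹ * a) ∈ A).Nonempty :=
    ⟨σ, Finset.mem_filter.2 ⟨hσ, by rwa [mul_inv_cancel_left]⟩⟩
  have hsum := Finset.sum_lt_sum (s := Finset.univ) (fun c _ => hle c)
    ⟨(φ σ)⁻¹ * a, Finset.mem_univ _, hcon _ hne⟩
  rw [← Finset.mul_sum, ← Nat.cast_sum, ← Nat.cast_sum, sum_card_filter_mul_mem,
    sum_card_filter_mul_mem, Nat.cast_mul, Nat.cast_mul] at hsum
  nlinarith [mul_le_mul_of_nonneg_right hB (Nat.cast_nonneg (α := ℝ) A.card)]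

section RelBoundary

variable [DecidableEq Γ]

/-- The `E`-boundary of `D` relative to a set `A` of fibres of `φ`: only the elements that are moved
out of `D` within the fibres over `A` count. -/
def relBoundary (φ : Γ →* G) (E : Finset Γ) (A : Finset G) (D : Finset Γ) : Finset Γ :=
  D.filter fun d => ∃ t ∈ E, φ (t * d) ∈ A ∧ t * d ∉ D

theorem mem_relBoundary {φ : Γ →* G} {E D : Finset Γ} {A : Finset G} {d : Γ} :
    d ∈ relBoundary φ E A D ↔ d ∈ D ∧ ∃ t ∈ E, φ (t * d) ∈ A ∧ t * d ∉ D :=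
  Finset.mem_filter

theorem exists_card_relBoundary_le [Finite G] {φ : Γ →* G} (hφ : Function.Surjective φ)
    {S E : Finset Γ} {η : ℝ} (hS : S.Nonempty) (hinj : Set.InjOn φ S) (hSE : IsInvariant E η S)
    {A : Finset G} (hA : A.Nonempty) :
    ∃ T : Finset Γ, T.Nonempty ∧ Set.InjOn φ T ∧ T.image φ ⊆ A ∧
      ((relBoundary φ E A T).card : ℝ) ≤ η * T.card := by
  rw [isInvariant_iff_card_boundary_le] at hSE
  obtain ⟨q, hne, hle⟩ := exists_card_filter_mul_mem_le φ hS hSE hA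
  obtain ⟨c, rfl⟩ := hφ q
  refine ⟨(S.filter fun σ => φ σ * φ c ∈ A).image (· * c), hne.image _, ?_, ?_, ?_⟩
  · intro _ hx _ hy hxy
    obtain ⟨σ, hσ, rfl⟩ := Finset.mem_image.1 (Finset.mem_coe.1 hx)
    obtain ⟨τ, hτ, rfl⟩ := Finset.mem_image.1 (Finset.mem_coe.1 hy)
    simp only [map_mul, mul_left_inj] at hxy ⊢
    exact hinj (Finset.mem_filter.1 hσ).1 (Finset.mem_filter.1 hτ).1 hxy
  · intro _ ha
    obtain ⟨_, hx, rfl⟩ := Finset.mem_image.1 ha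
    obtain ⟨σ, hσ, rfl⟩ := Finset.mem_image.1 hx
    rw [map_mul]
    exact (Finset.mem_filter.1 hσ).2
  · have hsub : relBoundary φ E A ((S.filter fun σ => φ σ * φ c ∈ A).image (· * c)) ⊆
        ((boundary E S).filter fun σ => φ σ * φ c ∈ A).image (· * c) := by
      intro _ hd
      obtain ⟨hd, t, ht, htA, htd⟩ := mem_relBoundary.1 hd
      obtain ⟨σ, hσ, rfl⟩ := Finset.mem_image.1 hd
      obtain ⟨hσS, hσA⟩ := Finset.mem_filter.1 hσ
      rw [← mul_assoc] at htA htd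
      refine Finset.mem_image_of_mem _ (Finset.mem_filter.2
        ⟨mem_boundary.2 ⟨hσS, t, ht, fun htσ => htd ?_⟩, hσA⟩)
      exact Finset.mem_image_of_mem (· * c) (Finset.mem_filter.2 ⟨htσ, by rwa [← map_mul]⟩)
    rw [Finset.card_image_of_injective _ (mul_left_injective c)]
    refine le_trans ?_ hle
    exact_mod_cast (Finset.card_le_card hsub).trans Finset.card_image_le

theorem card_relBoundary_union_le {φ : Γ →* G} {E : Finset Γ} (hE : ∀ t ∈ E, t⁻¹ ∈ E)
    {A : Finset G} {T D : Finset Γ} (hD : Set.BijOn φ D ↑(A \ T.image φ)) :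
    (relBoundary φ E A (T ∪ D)).card ≤
      (relBoundary φ E (A \ T.image φ) D).card +
        (1 + E.card) * (relBoundary φ E A T).card := by
  have hsub : relBoundary φ E A (T ∪ D) ⊆ relBoundary φ E (A \ T.image φ) D ∪
      (relBoundary φ E A T ∪ (E ×ˢ relBoundary φ E A T).image
        fun p => Function.invFunOn φ D (φ (p.1⁻¹ * p.2))) := by
    intro d hd
    obtain ⟨hd, t, ht, htA, htd⟩ := mem_relBoundary.1 hd
    rw [Finset.mem_union, not_or] at htd
    simp only [Finset.mem_union, mem_relBoundary]
    rcases Finset.mem_union.1 hd with hdT | hdD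
    · exact Or.inr (Or.inl ⟨hdT, t, ht, htA, htd.1⟩)
    by_cases htT : φ (t * d) ∈ T.image φ
    · obtain ⟨τ, hτ, hτd⟩ := Finset.mem_image.1 htT
      have hφd : φ (t⁻¹ * τ) = φ d := by rw [map_mul, hτd, ← map_mul, inv_mul_cancel_left]
      have hdA := Finset.mem_sdiff.1 (Finset.mem_coe.1 (hD.mapsTo hdD))
      refine Or.inr (Or.inr (Finset.mem_image.2 ⟨(t, τ), Finset.mem_product.2
        ⟨ht, mem_relBoundary.2 ⟨hτ, t⁻¹, hE t ht, hφd ▸ hdA.1, fun hmem => hdA.2 ?_⟩⟩, ?_⟩))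
      · exact hφd ▸ Finset.mem_image_of_mem φ hmem
      · rw [hφd]
        exact hD.injOn.leftInvOn_invFunOn hdD
    · exact Or.inl ⟨hdD, t, ht, Finset.mem_sdiff.2 ⟨htA, htT⟩, htd.2⟩
  refine (Finset.card_le_card hsub).trans <| (Finset.card_union_le _ _).trans <|
    Nat.add_le_add_left ((Finset.card_union_le _ _).trans ?_) _
  rw [add_mul, one_mul, ← Finset.card_product]
  exact Nat.add_le_add_left Finset.card_image_le _

theorem exists_bijOn_card_relBoundary_le [Finite G] {φ : Γ →* G} (hφ : Function.Surjective φ)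
    {S E : Finset Γ} {η : ℝ} (hS : S.Nonempty) (hinj : Set.InjOn φ S) (hSE : IsInvariant E η S)
    (hE : ∀ t ∈ E, t⁻¹ ∈ E) (A : Finset G) :
    ∃ D : Finset Γ, Set.BijOn φ D A ∧
      ((relBoundary φ E A D).card : ℝ) ≤ (1 + E.card) * η * A.card := by
  induction A using Finset.strongInduction with
  | H A ih =>
  rcases A.eq_empty_or_nonempty with rfl | hA
  · exact ⟨∅, by simp, by simp [relBoundary]⟩
  obtain ⟨T, hT, hTinj, hTA, hTle⟩ := exists_card_relBoundary_le hφ hS hinj hSE hA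
  obtain ⟨D, hD, hDle⟩ := ih (A \ T.image φ) (Finset.sdiff_ssubset hTA (hT.image φ))
  have hTbij : Set.BijOn φ T ↑(T.image φ) := by
    rw [Finset.coe_image]
    exact hTinj.bijOn_image
  refine ⟨T ∪ D, ?_, ?_⟩
  · have hunion : (A : Set G) = ↑(T.image φ) ∪ ↑(A \ T.image φ) := by
      rw [← Finset.coe_union, Finset.union_sdiff_of_subset hTA]
    rw [hunion, Finset.coe_union]
    have hne : ∀ x ∈ T, ∀ y ∈ D, φ x ≠ φ y := fun x hx y hy hxy =>
      (Finset.mem_sdiff.1 (hD.mapsTo hy)).2 (hxy ▸ Finset.mem_image_of_mem φ hx)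
    refine hTbij.union hD ((Set.injOn_union ?_).2 ⟨hTinj, hD.injOn, hne⟩)
    exact Set.disjoint_left.2 fun x hxT hxD => hne x hxT x hxD rfl
  · have hcard : (T.card : ℝ) + (A \ T.image φ).card = A.card := by
      rw [← Finset.card_image_of_injOn hTinj, add_comm]
      exact_mod_cast Finset.card_sdiff_add_card_eq_card hTA
    calc ((relBoundary φ E A (T ∪ D)).card : ℝ)
        ≤ (relBoundary φ E (A \ T.image φ) D).card +
            (1 + E.card) * (relBoundary φ E A T).card := by
          exact_mod_cast card_relBoundary_union_le hE hD
      _ ≤ (1 + E.card) * η * (A \ T.image φ).card + (1 + E.card) * (η * T.card) := by gcongr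
      _ = (1 + E.card) * η * A.card := by rw [← hcard]; ring

end RelBoundary

theorem exists_isTransversal_isInvariant {N Δ : Subgroup Γ} [Δ.Normal] [Δ.FiniteIndex]
    (hΔ : Δ ≤ N) {S E : Finset Γ} {η : ℝ} (hS : S.Nonempty)
    (hinj : Set.InjOn (QuotientGroup.mk (s := Δ)) S) (hSE : IsInvariant E η S)
    (hE : ∀ t ∈ E, t⁻¹ ∈ E) (hEN : (E : Set Γ) ⊆ N) :
    ∃ D : Finset Γ, IsTransversal D N Δ ∧ IsInvariant E ((1 + E.card) * η) D := by
  classical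
  have := Fintype.ofFinite (Γ ⧸ Δ)
  let A : Finset (Γ ⧸ Δ) := Finset.univ.filter fun q => q ∈ N.map (QuotientGroup.mk' Δ)
  have hA : ∀ g : Γ, QuotientGroup.mk' Δ g ∈ A ↔ g ∈ N := fun g => by
    rw [Finset.mem_filter, ← Subgroup.mem_comap, Subgroup.comap_map_eq_self]
    · exact and_iff_right (Finset.mem_univ _)
    · rwa [QuotientGroup.ker_mk']
  obtain ⟨D, hD, hDle⟩ := exists_bijOn_card_relBoundary_le (QuotientGroup.mk'_surjective Δ) hS
    hinj hSE hE A
  have hDN : (D : Set Γ) ⊆ N := fun d hd => (hA d).1 (hD.mapsTo hd)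
  refine ⟨D, ⟨hDN, hD.injOn, fun g hg => ?_⟩, isInvariant_iff_card_boundary_le.2 ?_⟩
  · obtain ⟨d, hd, hdg⟩ := hD.surjOn ((hA g).2 hg)
    exact ⟨d, hd, QuotientGroup.eq.1 hdg⟩
  · have hboundary : boundary E D = relBoundary (QuotientGroup.mk' Δ) E A D := by
      ext d
      simp only [mem_boundary, mem_relBoundary, hA]
      exact and_congr_right fun hd => exists_congr fun t => and_congr_right fun ht =>
        (and_iff_right (N.mul_mem (hEN ht) (hDN hd))).symm
    have hcard : D.card = A.card := Finset.card_nbij _ hD.mapsTo hD.injOn hD.surjOn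
    rwa [hboundary, hcard]

end AlmostInvariantTransversals

section GenericRepresentatives

variable {Γ : Type*} [Group Γ] {Δ H : Subgroup Γ}

theorem exists_mem_forall_inv_mul_mul_notMem [Δ.FiniteIndex] (hH : ¬ H.FiniteIndex)
    (W : Finset (Γ × Γ)) : ∃ δ ∈ Δ, ∀ p ∈ W, p.1⁻¹ * δ * p.2 ∉ H := by
  classical
  by_contra! hcon
  have := Fintype.ofFinite (Γ ⧸ Δ)
  let K : Γ × Γ → Subgroup Γ := fun p => H.map (MulAut.conj p.2).toMonoidHom
  have hcover : ⋃ i ∈ (Finset.univ : Finset (Γ ⧸ Δ)) ×ˢ W,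
      (i.1.out * (i.2.1 * i.2.2⁻¹)) • (K i.2 : Set Γ) = Set.univ := by
    refine Set.eq_univ_of_forall fun g => ?_
    obtain ⟨p, hp, hpH⟩ := hcon ((g : Γ ⧸ Δ).out⁻¹ * g)
      (QuotientGroup.eq.1 (QuotientGroup.out_eq' (g : Γ ⧸ Δ)))
    refine Set.mem_iUnion₂.2 ⟨((g : Γ ⧸ Δ), p), Finset.mem_product.2 ⟨Finset.mem_univ _, hp⟩,
      Set.mem_smul_set.2 ⟨_, ⟨_, hpH, rfl⟩, ?_⟩⟩
    simp only [MulEquiv.coe_toMonoidHom, MulAut.conj_apply, smul_eq_mul]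
    group
  obtain ⟨i, -, hi⟩ := Subgroup.exists_finiteIndex_of_leftCoset_cover hcover
  exact hH ⟨fun h => hi.index_ne_zero ((Subgroup.index_map_equiv H (MulAut.conj i.2.2)).trans h)⟩

theorem exists_section_injOn [Δ.FiniteIndex] (hH : ¬ H.FiniteIndex) {X : Finset Γ}
    (hX : Set.InjOn (QuotientGroup.mk (s := H ⊓ Δ)) X) :
    ∃ d : Γ ⧸ Δ → Γ, (∀ q, (d q : Γ ⧸ Δ) = q) ∧
      Set.InjOn (fun x : Γ => QuotientGroup.mk (s := H) ((d x)⁻¹ * x)) X := by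
  classical
  have := Fintype.ofFinite (Γ ⧸ Δ)
  suffices h : ∀ A : Finset (Γ ⧸ Δ), ∃ d : Γ ⧸ Δ → Γ, (∀ q, (d q : Γ ⧸ Δ) = q) ∧
      ∀ x ∈ X, ∀ y ∈ X, (x : Γ ⧸ Δ) ∈ A → (y : Γ ⧸ Δ) ∈ A →
        ((d x)⁻¹ * x)⁻¹ * ((d y)⁻¹ * y) ∈ H → x = y by
    obtain ⟨d, hd, hinj⟩ := h Finset.univ
    exact ⟨d, hd, fun x hx y hy hxy => hinj x hx y hy (Finset.mem_univ _) (Finset.mem_univ _)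
      (QuotientGroup.eq.1 hxy)⟩
  intro A
  induction A using Finset.induction_on with
  | empty => exact ⟨Quotient.out, QuotientGroup.out_eq', by simp⟩
  | insert q A hq ih =>
    obtain ⟨d, hd, hinj⟩ := ih
    obtain ⟨δ, hδ, hgeneric⟩ := exists_mem_forall_inv_mul_mul_notMem (Δ := Δ) hH
      ((X ×ˢ X).image fun p => ((d q)⁻¹ * p.1, (d p.2)⁻¹ * p.2))
    have hcross : ∀ x ∈ X, ∀ y ∈ X, ((d q * δ)⁻¹ * x)⁻¹ * ((d y)⁻¹ * y) ∉ H := fun x hx y hy => by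
      simpa [mul_assoc] using
        hgeneric _ (Finset.mem_image_of_mem _ (Finset.mk_mem_product hx hy))
    refine ⟨Function.update d q (d q * δ), fun r => ?_, fun x hx y hy hxA hyA hxy => ?_⟩
    · rcases eq_or_ne r q with rfl | hr
      · rw [Function.update_self, QuotientGroup.mk_mul_of_mem _ hδ, hd]
      · rw [Function.update_of_ne hr, hd]
    rcases eq_or_ne (x : Γ ⧸ Δ) q with hxq | hxq <;> rcases eq_or_ne (y : Γ ⧸ Δ) q with hyq | hyq
    · rw [hxq, hyq, Function.update_self] at hxy
      exact hX hx hy (QuotientGroup.eq.2 ⟨by simpa [mul_assoc] using hxy,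
        QuotientGroup.eq.1 (hxq.trans hyq.symm)⟩)
    · rw [hxq, Function.update_self, Function.update_of_ne hyq] at hxy
      exact (hcross x hx y hy hxy).elim
    · rw [hyq, Function.update_self, Function.update_of_ne hxq] at hxy
      exact (hcross y hy x hx (by simpa [mul_assoc] using H.inv_mem hxy)).elim
    · rw [Function.update_of_ne hxq, Function.update_of_ne hyq] at hxy
      exact hinj x hx y hy (Finset.mem_of_mem_insert_of_ne hxA hxq)
        (Finset.mem_of_mem_insert_of_ne hyA hyq) hxy

theorem exists_section_injOn_map_one [Δ.FiniteIndex] (hH : ¬ H.FiniteIndex)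
    {X : Finset Γ} (hX : Set.InjOn (QuotientGroup.mk (s := H ⊓ Δ)) X) :
    ∃ d : Γ ⧸ Δ → Γ, (∀ q, (d q : Γ ⧸ Δ) = q) ∧ d (1 : Γ) = 1 ∧
      Set.InjOn (fun x : Γ => QuotientGroup.mk (s := H) ((d x)⁻¹ * x)) X := by
  obtain ⟨d, hd, hinj⟩ := exists_section_injOn hH hX
  have hd₁ : (d (1 : Γ))⁻¹ ∈ Δ := Δ.inv_mem <| by
    simpa using QuotientGroup.eq.1 (hd (1 : Γ)).symm
  refine ⟨fun q => d q * (d (1 : Γ))⁻¹, fun q => ?_, mul_inv_cancel _, fun x hx y hy hxy => ?_⟩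
  · rw [QuotientGroup.mk_mul_of_mem _ hd₁, hd]
  · exact hinj hx hy (QuotientGroup.eq.2 (by simpa [mul_assoc] using QuotientGroup.eq.1 hxy))

theorem exists_subset_mul_injOn_mk [DecidableEq Γ] [Δ.FiniteIndex] (hH : ¬ H.FiniteIndex)
    {X : Finset Γ} (hX : Set.InjOn (QuotientGroup.mk (s := H ⊓ Δ)) X) (h1X : 1 ∈ X) :
    ∃ P Z : Finset Γ, X ⊆ P * Z ∧ 1 ∈ P ∧ 1 ∈ Z ∧ P.card ≤ X.card ∧
      Set.InjOn (QuotientGroup.mk (s := Δ)) P ∧ Set.InjOn (QuotientGroup.mk (s := H)) Z ∧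
      (Z : Set Γ) ⊆ Δ ∧ ∀ p ∈ P, ∃ x ∈ X, p⁻¹ * x ∈ Δ := by
  obtain ⟨d, hd, hd₁, hinj⟩ := exists_section_injOn_map_one hH hX
  have hdΔ : ∀ x : Γ, (d x)⁻¹ * x ∈ Δ := fun x => QuotientGroup.eq.1 (hd x)
  refine ⟨X.image fun x : Γ => d x, X.image fun x : Γ => (d x)⁻¹ * x, fun x hx => ?_, ?_, ?_,
    Finset.card_image_le, ?_, ?_, ?_, ?_⟩
  · exact Finset.mem_mul.2 ⟨d x, Finset.mem_image_of_mem _ hx, _, Finset.mem_image_of_mem _ hx,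
      mul_inv_cancel_left _ _⟩
  · exact Finset.mem_image.2 ⟨1, h1X, hd₁⟩
  · exact Finset.mem_image.2 ⟨1, h1X, by rw [hd₁, mul_one, inv_one]⟩
  · rw [Finset.coe_image]
    rintro _ ⟨x, -, rfl⟩ _ ⟨y, -, rfl⟩ hxy
    exact congrArg d ((hd x).symm.trans (hxy.trans (hd y)))
  · rw [Finset.coe_image]
    exact hinj.image_of_comp
  · rw [Finset.coe_image]
    rintro _ ⟨x, -, rfl⟩
    exact hdΔ x
  · intro p hp
    obtain ⟨x, hx, rfl⟩ := Finset.mem_image.1 hp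
    exact ⟨x, hx, hdΔ x⟩

end GenericRepresentatives

section ResiduallyFiniteGroups

variable {Γ : Type*} [Group Γ]

theorem exists_normal_finiteIndex_injOn_mk [Group.ResiduallyFinite Γ] (N : Subgroup Γ) [N.Normal]
    [N.FiniteIndex] (S : Finset Γ) :
    ∃ Δ ≤ N, Δ.Normal ∧ Δ.FiniteIndex ∧ Set.InjOn (QuotientGroup.mk (s := Δ)) S := by
  classical
  suffices h : ∀ T : Finset Γ, 1 ∉ T → ∃ Δ ≤ N, Δ.Normal ∧ Δ.FiniteIndex ∧ ∀ x ∈ T, x ∉ Δ by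
    obtain ⟨Δ, hΔ, hn, hf, h⟩ := h ((S⁻¹ * S).erase 1) (Finset.notMem_erase _ _)
    refine ⟨Δ, hΔ, hn, hf, fun x hx y hy hxy => ?_⟩
    by_contra hne
    refine h (x⁻¹ * y) (Finset.mem_erase.2 ⟨?_, ?_⟩) (QuotientGroup.eq.1 hxy)
    · rwa [Ne, inv_mul_eq_one]
    · exact Finset.mul_mem_mul (Finset.inv_mem_inv hx) hy
  intro T
  induction T using Finset.induction_on with
  | empty => exact fun _ => ⟨N, le_rfl, inferInstance, inferInstance, by simp⟩
  | insert x T _ ih =>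
    intro h1
    rw [Finset.mem_insert, not_or] at h1
    obtain ⟨Δ, hΔ, hn, hf, h⟩ := ih h1.2
    obtain ⟨M, hM⟩ := Group.exists_finiteIndexNormalSubgroup_notMem x (Ne.symm h1.1)
    refine ⟨Δ ⊓ M.toSubgroup, inf_le_left.trans hΔ, inferInstance, inferInstance, ?_⟩
    exact (Finset.forall_mem_insert _ _ _).2 ⟨fun hxΔ => hM hxΔ.2, fun y hy hyΔ => h y hy hyΔ.1⟩

theorem not_finiteIndex_zpowers {a : Γ} (ha : (conjugatesOf a).Infinite) :
    ¬ (Subgroup.zpowers a).FiniteIndex := by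
  intro hfin
  refine ha ((Set.finite_range fun u : Γ ⧸ Subgroup.zpowers a =>
    u.out * a * u.out⁻¹).subset fun b hb => ?_)
  obtain ⟨g, rfl⟩ := isConj_iff.1 hb
  obtain ⟨⟨h, hh⟩, hg⟩ := QuotientGroup.mk_out_eq_mul (Subgroup.zpowers a) g
  obtain ⟨k, rfl⟩ := Subgroup.mem_zpowers_iff.1 hh
  refine ⟨(g : Γ ⧸ Subgroup.zpowers a), ?_⟩
  simp only [hg]
  group

theorem ncard_conjugatesOf_mul_orderOf_le {G : Type*} [Group G] [Finite G] (q : G) :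
    (conjugatesOf q).ncard * orderOf q ≤ Nat.card G := by
  have horbit : (conjugatesOf q).ncard = (MulAction.stabilizer (ConjAct G) q).index := by
    rw [MulAction.index_stabilizer, ConjAct.orbit_eq_carrier_conjClasses]
    rfl
  have hcentral : Subgroup.zpowers q ≤ Subgroup.centralizer {q} :=
    Subgroup.zpowers_le.2 (Subgroup.mem_centralizer_singleton_iff.2 rfl)
  calc (conjugatesOf q).ncard * orderOf q
      ≤ (MulAction.stabilizer (ConjAct G) q).index * Nat.card (Subgroup.centralizer {q}) := by
        rw [horbit, ← Nat.card_zpowers]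
        exact Nat.mul_le_mul_left _ (Subgroup.card_le_of_le hcentral)
    _ = Nat.card G := by
        rw [Subgroup.nat_card_centralizer_nat_card_stabilizer]
        exact Subgroup.index_mul_card _

theorem exists_normal_finiteIndex_mul_relIndex_zpowers_le [Group.ResiduallyFinite Γ] {a : Γ}
    (ha : (conjugatesOf a).Infinite) (N : Subgroup Γ) [N.Normal] [N.FiniteIndex] (S : Finset Γ)
    (B : ℕ) :
    ∃ Δ ≤ N, Δ.Normal ∧ Δ.FiniteIndex ∧ Set.InjOn (QuotientGroup.mk (s := Δ)) S ∧
      B * Δ.relIndex (Subgroup.zpowers a) ≤ Δ.relIndex N := by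
  classical
  obtain ⟨T, hT, hTcard⟩ := ha.exists_subset_card_eq (N.index * B)
  obtain ⟨Δ, hΔ, hn, hf, hinj⟩ := exists_normal_finiteIndex_injOn_mk N (S ∪ T)
  rw [Finset.coe_union] at hinj
  refine ⟨Δ, hΔ, hn, hf, hinj.mono Set.subset_union_left, ?_⟩
  have horder : Δ.relIndex (Subgroup.zpowers a) = orderOf (a : Γ ⧸ Δ) := by
    rw [← Nat.card_zpowers, ← QuotientGroup.coe_mk', ← MonoidHom.map_zpowers,
      ← Subgroup.relIndex_ker, QuotientGroup.ker_mk']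
  have hconj : T.card ≤ (conjugatesOf (a : Γ ⧸ Δ)).ncard := by
    rw [← Set.ncard_coe_finset, ← (hinj.mono Set.subset_union_right).ncard_image]
    refine Set.ncard_le_ncard ?_ (Set.toFinite _)
    rintro _ ⟨t, ht, rfl⟩
    exact (QuotientGroup.mk' Δ).map_isConj (hT ht)
  refine Nat.le_of_mul_le_mul_left ?_ (Nat.pos_of_ne_zero N.index_ne_zero_of_finite)
  calc N.index * (B * Δ.relIndex (Subgroup.zpowers a))
      = T.card * orderOf (a : Γ ⧸ Δ) := by rw [hTcard, horder, mul_assoc]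
    _ ≤ (conjugatesOf (a : Γ ⧸ Δ)).ncard * orderOf (a : Γ ⧸ Δ) := Nat.mul_le_mul_right _ hconj
    _ ≤ Nat.card (Γ ⧸ Δ) := ncard_conjugatesOf_mul_orderOf_le _
    _ = N.index * Δ.relIndex N := by
        rw [← Subgroup.index_eq_card, mul_comm, Subgroup.relIndex_mul_index hΔ]

theorem exists_normal_isTransversal_isInvariant [Group.ResiduallyFinite Γ] (hΓ : IsAmenable Γ)
    {a : Γ} (ha : (conjugatesOf a).Infinite) (N : Subgroup Γ) [N.Normal] [N.FiniteIndex]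
    {E : Finset Γ} (hEN : (E : Set Γ) ⊆ N) (hE : ∀ t ∈ E, t⁻¹ ∈ E) (S : Finset Γ) {ε : ℝ}
    (hε : 0 < ε) (B : ℕ) :
    ∃ Δ ≤ N, Δ.Normal ∧ Δ.FiniteIndex ∧ Set.InjOn (QuotientGroup.mk (s := Δ)) S ∧
      B * Δ.relIndex (Subgroup.zpowers a) ≤ Δ.relIndex N ∧
        ∃ D : Finset Γ, IsTransversal D N Δ ∧ IsInvariant E ε D := by
  classical
  obtain ⟨T, hT, hTE⟩ := hΓ E (ε / (1 + E.card)) (by positivity)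
  obtain ⟨Δ, hΔ, hnormal, hfinite, hinj, hB⟩ :=
    exists_normal_finiteIndex_mul_relIndex_zpowers_le ha N (S ∪ T) B
  rw [Finset.coe_union] at hinj
  obtain ⟨D, hD, hDE⟩ := exists_isTransversal_isInvariant hΔ hT
    (hinj.mono Set.subset_union_right) hTE hE hEN
  rw [mul_div_cancel₀ ε (by positivity)] at hDE
  exact ⟨Δ, hΔ, hnormal, hfinite, hinj.mono Set.subset_union_left, hB, D, hD, hDE⟩

end ResiduallyFiniteGroups

section FiniteIndexLevels

variable {Γ : Type*} [Group Γ] {H N : Subgroup Γ}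

theorem IsTransversal.eq_and_eq_of_mul_eq {F : Finset Γ} {M : Subgroup Γ} (hF : IsTransversal F M N)
    {f f' w w' : Γ} (hf : f ∈ F) (hf' : f' ∈ F) (hw : w ∈ N) (hw' : w' ∈ N)
    (h : f * w = f' * w') : f = f' ∧ w = w' := by
  obtain rfl := hF.injOn hf hf' <| by
    rw [← QuotientGroup.mk_mul_of_mem f hw, h, QuotientGroup.mk_mul_of_mem f' hw']
  exact ⟨rfl, mul_left_cancel h⟩

theorem IsInvariant.mul_right [DecidableEq Γ] {E F W : Finset Γ} {δ : ℝ} (h : IsInvariant E δ F)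
    (hcard : (F * W).card = F.card * W.card) : IsInvariant E δ (F * W) := by
  rw [isInvariant_iff_card_boundary_le] at h ⊢
  have hsub : boundary E (F * W) ⊆ boundary E F * W := by
    intro s hs
    obtain ⟨hs, t, ht, hts⟩ := mem_boundary.1 hs
    obtain ⟨f, hf, w, hw, rfl⟩ := Finset.mem_mul.1 hs
    refine Finset.mul_mem_mul (mem_boundary.2 ⟨hf, t, ht, fun htf => hts ?_⟩) hw
    rw [← mul_assoc]
    exact Finset.mul_mem_mul htf hw
  calc ((boundary E (F * W)).card : ℝ)
      ≤ (boundary E F).card * W.card := by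
        exact_mod_cast (Finset.card_le_card hsub).trans Finset.card_mul_le
    _ ≤ δ * F.card * W.card := by gcongr
    _ = δ * (F * W).card := by rw [hcard]; push_cast; ring

theorem IsTransversal.exists_isInvariant_mul [DecidableEq Γ] [N.Normal] {F : Finset Γ}
    (hF : IsTransversal F ⊤ N) (E : Finset Γ) :
    ∃ E' : Finset Γ, (E' : Set Γ) ⊆ N ∧ (∀ t ∈ E', t⁻¹ ∈ E') ∧
      ∀ (D : Finset Γ) (ε : ℝ), (D : Set Γ) ⊆ N → IsInvariant E' ε D → IsInvariant E ε (F * D) := by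
  classical
  let T := F⁻¹ * (E * F)
  refine ⟨(T ∪ T⁻¹).filter (· ∈ N), fun t ht => (Finset.mem_filter.1 ht).2, fun t ht => ?_,
    fun D ε hDN hD => ?_⟩
  · simp only [Finset.mem_filter, Finset.mem_union, Finset.mem_inv', inv_inv, inv_mem_iff] at ht ⊢
    exact ⟨ht.1.symm, ht.2⟩
  rw [isInvariant_iff_card_boundary_le] at hD ⊢
  have hsub : boundary E (F * D) ⊆ F * boundary ((T ∪ T⁻¹).filter (· ∈ N)) D := by
    intro s hs
    obtain ⟨hs, t, ht, hts⟩ := mem_boundary.1 hs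
    obtain ⟨f, hf, d, hd, rfl⟩ := Finset.mem_mul.1 hs
    obtain ⟨f', hf', hmem⟩ := hF.exists_inv_mul_mem (t * f) (Subgroup.mem_top _)
    refine Finset.mul_mem_mul hf (mem_boundary.2 ⟨hd, f'⁻¹ * (t * f), ?_, fun h => hts ?_⟩)
    · exact Finset.mem_filter.2 ⟨Finset.mem_union_left _ (Finset.mul_mem_mul
        (Finset.inv_mem_inv hf') (Finset.mul_mem_mul ht hf)), hmem⟩
    · simpa [mul_assoc] using Finset.mul_mem_mul hf' h
  have hcard : (F * D).card = F.card * D.card :=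
    card_mul_of_injOn_mk hF.injOn 1 fun d hd => (QuotientGroup.eq_one_iff d).2 (hDN hd)
  calc ((boundary E (F * D)).card : ℝ)
      ≤ F.card * (boundary ((T ∪ T⁻¹).filter (· ∈ N)) D).card := by
        exact_mod_cast (Finset.card_le_card hsub).trans Finset.card_mul_le
    _ ≤ F.card * (ε * D.card) := by gcongr
    _ = ε * (F * D).card := by rw [hcard]; push_cast; ring

theorem ncard_inter_rightTranslate_le [N.Normal] [N.FiniteIndex] {F : Finset Γ}
    (hF : Set.InjOn (QuotientGroup.mk (s := N)) F) (H : Subgroup Γ) (c : Γ) :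
    ((H : Set Γ) ∩ (rightTranslate F c : Finset Γ)).ncard ≤ N.relIndex H := by
  rw [← Nat.card_coe_set_eq]
  refine Nat.card_le_card_of_injective
    (fun x => (QuotientGroup.mk ⟨x.1, x.2.1⟩ : H ⧸ N.subgroupOf H)) ?_
  rintro ⟨x, hxH, hx⟩ ⟨y, hyH, hy⟩ hxy
  have hxyN : x⁻¹ * y ∈ N := Subgroup.mem_subgroupOf.1 (QuotientGroup.eq.1 hxy)
  have hconj : (x * c⁻¹)⁻¹ * (y * c⁻¹) ∈ N := by
    simpa [mul_assoc] using Subgroup.Normal.conj_mem ‹N.Normal› _ hxyN c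
  exact Subtype.ext (mul_right_cancel
    (hF (mem_rightTranslate.1 hx) (mem_rightTranslate.1 hy) (QuotientGroup.eq.2 hconj)))

theorem ncard_inter_rightTranslate_mul_le [DecidableEq Γ] [N.Normal] [N.FiniteIndex] {F : Finset Γ}
    (hF : Set.InjOn (QuotientGroup.mk (s := N)) F) (H : Subgroup Γ) (W : Finset Γ) (c : Γ) :
    ((H : Set Γ) ∩ (rightTranslate (F * W) c : Finset Γ)).ncard ≤ W.card * N.relIndex H := by
  have hsub : (H : Set Γ) ∩ (rightTranslate (F * W) c : Finset Γ) ⊆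
      ⋃ w ∈ W, (H : Set Γ) ∩ (rightTranslate F (w * c) : Finset Γ) := by
    rintro x ⟨hxH, hx⟩
    obtain ⟨f, hf, w, hw, hfw⟩ := Finset.mem_mul.1 (mem_rightTranslate.1 hx)
    refine Set.mem_iUnion₂.2 ⟨w, hw, hxH, mem_rightTranslate.2 ?_⟩
    rwa [mul_inv_rev, ← mul_assoc, ← hfw, mul_inv_cancel_right]
  calc ((H : Set Γ) ∩ (rightTranslate (F * W) c : Finset Γ)).ncard
      ≤ (⋃ w ∈ W, (H : Set Γ) ∩ (rightTranslate F (w * c) : Finset Γ)).ncard :=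
        Set.ncard_le_ncard hsub
          (W.finite_toSet.biUnion fun w _ => (Finset.finite_toSet _).inter_of_right _)
    _ ≤ ∑ w ∈ W, ((H : Set Γ) ∩ (rightTranslate F (w * c) : Finset Γ)).ncard :=
        Finset.set_ncard_biUnion_le _ _
    _ ≤ W.card * N.relIndex H :=
        Finset.sum_le_card_nsmul _ _ _ fun w _ => ncard_inter_rightTranslate_le hF H _

/-- The two kinds of tiles used at every level: the regular ones tile the bulk of the group, the
special ones also cover the distinguished subgroup. -/
inductive TileKind
  | regular
  | special
  deriving DecidableEq

instance : Fintype TileKind where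
  elems := {.regular, .special}
  complete := by rintro (_ | _) <;> simp

/-- The data of one tiling: a transversal `F` of a normal subgroup `N` of finite index is the
regular shape, and `F Z` is the special shape, where `Z ⊆ N` is a finite set of elements that are
distinct modulo `H` such that the translates of `F Z` by `H ∩ N` cover `H`. -/
structure Level (H : Subgroup Γ) where
  N : Subgroup Γ
  [normal : N.Normal]
  [finiteIndex : N.FiniteIndex]
  F : Finset Γ
  Z : Finset Γ
  isTransversal_F : IsTransversal F ⊤ N
  one_mem_F : 1 ∈ F
  one_mem_Z : 1 ∈ Z
  Z_subset : (Z : Set Γ) ⊆ N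
  injOn_Z : Set.InjOn (QuotientGroup.mk (s := H)) Z
  covers : ∀ h ∈ H, ∃ f ∈ F, ∃ z ∈ Z, ∃ l ∈ H ⊓ N, h = f * z * l

namespace Level

attribute [instance] Level.normal Level.finiteIndex

variable (H) in
/-- The level whose tiles are the singletons. -/
def top : Level H where
  N := ⊤
  F := {1}
  Z := {1}
  isTransversal_F := ⟨by simp, by simp, by simp⟩
  one_mem_F := Finset.mem_singleton_self 1
  one_mem_Z := Finset.mem_singleton_self 1
  Z_subset := by simp
  injOn_Z := by simp
  covers := fun h hh => ⟨1, by simp, 1, by simp, h, by simpa using hh, by simp⟩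

variable (ℓ : Level H)

theorem card_F : ℓ.F.card = ℓ.N.index := by
  rw [ℓ.isTransversal_F.card_eq, Subgroup.relIndex_top_right]

/-- The set `W` such that the tiles of a given kind have shape `F W`. -/
def core : TileKind → Finset Γ
  | .regular => {1}
  | .special => ℓ.Z

theorem one_mem_core (b : TileKind) : 1 ∈ ℓ.core b :=
  match b with
  | .regular => Finset.mem_singleton_self 1
  | .special => ℓ.one_mem_Z

theorem core_subset (b : TileKind) : (ℓ.core b : Set Γ) ⊆ ℓ.N :=
  match b with
  | .regular => by simp [core]
  | .special => ℓ.Z_subset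

variable [DecidableEq Γ]

/-- The shape of the tiles of a given kind. -/
def shape (b : TileKind) : Finset Γ := ℓ.F * ℓ.core b

theorem one_mem_shape (b : TileKind) : 1 ∈ ℓ.shape b := by
  simpa [shape] using Finset.mul_mem_mul ℓ.one_mem_F (ℓ.one_mem_core b)

theorem injOn_shape_special :
    Set.InjOn (QuotientGroup.mk (s := H ⊓ ℓ.N)) (ℓ.shape .special) := by
  intro x hx y hy hxy
  obtain ⟨f, hf, z, hz, rfl⟩ := Finset.mem_mul.1 hx
  obtain ⟨f', hf', z', hz', rfl⟩ := Finset.mem_mul.1 hy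
  obtain ⟨n, hn, heq⟩ : ∃ n ∈ H ⊓ ℓ.N, f * (z * n) = f' * z' :=
    ⟨_, QuotientGroup.eq.1 hxy, by rw [← mul_assoc, mul_inv_cancel_left]⟩
  obtain ⟨rfl, hzn⟩ := ℓ.isTransversal_F.eq_and_eq_of_mul_eq hf hf'
    (ℓ.N.mul_mem (ℓ.Z_subset hz) hn.2) (ℓ.Z_subset hz') heq
  rw [ℓ.injOn_Z hz hz' (by rw [← hzn, QuotientGroup.mk_mul_of_mem _ hn.1])]

theorem card_shape (b : TileKind) : (ℓ.shape b).card = ℓ.F.card * (ℓ.core b).card :=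
  card_mul_of_injOn_mk ℓ.isTransversal_F.injOn 1 fun _ hw =>
    (QuotientGroup.eq_one_iff _).2 (ℓ.core_subset b hw)

theorem isInvariant_shape {E : Finset Γ} {δ : ℝ} (h : IsInvariant E δ ℓ.F) (b : TileKind) :
    IsInvariant E δ (ℓ.shape b) :=
  h.mul_right (ℓ.card_shape b)

theorem mul_ncard_inter_tile_le {B : ℕ} (hB : B * ℓ.N.relIndex H ≤ ℓ.N.index) (b : TileKind)
    (c : Γ) : B * ((H : Set Γ) ∩ (rightTranslate (ℓ.shape b) c : Finset Γ)).ncard ≤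
      (rightTranslate (ℓ.shape b) c).card := by
  calc B * ((H : Set Γ) ∩ (rightTranslate (ℓ.shape b) c : Finset Γ)).ncard
      ≤ B * ((ℓ.core b).card * ℓ.N.relIndex H) := Nat.mul_le_mul_left _ <|
        ncard_inter_rightTranslate_mul_le ℓ.isTransversal_F.injOn H _ c
    _ = B * ℓ.N.relIndex H * (ℓ.core b).card := by ring
    _ ≤ ℓ.N.index * (ℓ.core b).card := Nat.mul_le_mul_right _ hB
    _ = (rightTranslate (ℓ.shape b) c).card := by
        rw [rightTranslate, Finset.card_map, card_shape, card_F]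

theorem mul_mem_tile_iff {b : TileKind} {f w c : Γ} (hf : f ∈ ℓ.F) (hw : w ∈ ℓ.N) (hc : c ∈ ℓ.N) :
    f * w ∈ rightTranslate (ℓ.shape b) c ↔ w * c⁻¹ ∈ ℓ.core b := by
  rw [mem_rightTranslate, mul_assoc]
  refine ⟨fun h => ?_, Finset.mul_mem_mul hf⟩
  obtain ⟨f', hf', w', hw', heq⟩ := Finset.mem_mul.1 h
  rw [← (ℓ.isTransversal_F.eq_and_eq_of_mul_eq hf' hf (ℓ.core_subset b hw')
    (ℓ.N.mul_mem hw (ℓ.N.inv_mem hc)) heq).2]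
  exact hw'

end Level

end FiniteIndexLevels

section TransversalSupersets

variable {Γ : Type*} [Group Γ] {H N Δ : Subgroup Γ}

theorem IsTransversal.exists_mem_forall_inv_mul_notMem {D Y : Finset Γ} (hD : IsTransversal D N Δ)
    (hY : Y.card < D.card) : ∃ d ∈ D, ∀ y ∈ Y, d⁻¹ * y ∉ Δ := by
  classical
  obtain ⟨q, hqD, hqY⟩ : ∃ q ∈ D.image (QuotientGroup.mk (s := Δ)),
      q ∉ Y.image (QuotientGroup.mk (s := Δ)) := by
    refine Finset.exists_mem_notMem_of_card_lt_card (Finset.card_image_le.trans_lt ?_)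
    rwa [Finset.card_image_of_injOn hD.injOn]
  obtain ⟨d, hd, rfl⟩ := Finset.mem_image.1 hqD
  exact ⟨d, hd, fun y hy hyΔ =>
    hqY (Finset.mem_image.2 ⟨y, hy, (QuotientGroup.eq.2 hyΔ).symm⟩)⟩

variable [DecidableEq Γ]

theorem exists_mul_singleton_forall_inv_mul_notMem [Δ.Normal] {D Z X : Finset Γ}
    (hD : IsTransversal D N Δ) (hZ : Set.InjOn (QuotientGroup.mk (s := Δ)) Z)
    (hcard : Z.card * X.card < D.card) :
    ∃ c ∈ N, Set.InjOn (QuotientGroup.mk (s := Δ)) (Z * {c} : Finset Γ) ∧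
      ∀ y ∈ Z * {c}, ∀ x ∈ X, y⁻¹ * x ∉ Δ := by
  have hlt : (Z⁻¹ * X).card < D.card :=
    Finset.card_mul_le.trans_lt (by rwa [Finset.card_inv])
  obtain ⟨c, hcD, hc⟩ := hD.exists_mem_forall_inv_mul_notMem hlt
  refine ⟨c, hD.subset hcD, ?_, fun y hy x hx => ?_⟩
  · intro y hy y' hy' hyy
    obtain ⟨z, hz, _, hc', rfl⟩ := Finset.mem_mul.1 hy
    obtain ⟨z', hz', _, hc'', rfl⟩ := Finset.mem_mul.1 hy'
    obtain rfl := Finset.mem_singleton.1 hc'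
    obtain rfl := Finset.mem_singleton.1 hc''
    rw [QuotientGroup.mk_mul, QuotientGroup.mk_mul, mul_left_inj] at hyy
    rw [hZ hz hz' hyy]
  · obtain ⟨z, hz, _, hc', rfl⟩ := Finset.mem_mul.1 hy
    obtain rfl := Finset.mem_singleton.1 hc'
    simpa [mul_assoc] using hc _ (Finset.mul_mem_mul (Finset.inv_mem_inv hz) hx)

theorem IsTransversal.exists_superset_mul [Δ.Normal] [Δ.FiniteIndex] (hH : ¬ H.FiniteIndex)
    (hΔ : Δ ≤ N) {X Z D₀ : Finset Γ} (hD₀ : IsTransversal D₀ N Δ) (hXN : (X : Set Γ) ⊆ N)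
    (hX : Set.InjOn (QuotientGroup.mk (s := H ⊓ Δ)) X) (h1X : 1 ∈ X) (hZN : (Z : Set Γ) ⊆ N)
    (hZ : Set.InjOn (QuotientGroup.mk (s := Δ)) Z) (hcard : Z.card * X.card < D₀.card)
    (E : Finset Γ) :
    ∃ (D Z' : Finset Γ) (c : Γ), IsTransversal D N Δ ∧ 1 ∈ D ∧ X ⊆ D * Z' ∧ Z * {c} ⊆ D ∧
      1 ∈ Z' ∧ (Z' : Set Γ) ⊆ Δ ∧ Set.InjOn (QuotientGroup.mk (s := H)) Z' ∧
      (boundary E D).card ≤ (boundary E D₀).card + (1 + E.card) * (X.card + Z.card) := by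
  obtain ⟨P, Z', hXP, h1P, h1Z', hPcard, hP, hZ', hZ'Δ, hPX⟩ :=
    exists_subset_mul_injOn_mk hH hX h1X
  obtain ⟨c, hcN, hZc, hZcX⟩ := exists_mul_singleton_forall_inv_mul_notMem hD₀ hZ hcard
  have hPN : (P : Set Γ) ⊆ N := fun p hp => by
    obtain ⟨x, hx, hpx⟩ := hPX p hp
    exact (N.mul_mem_cancel_right (hΔ hpx)).1 (by simpa using hXN hx)
  have hPZc : ∀ p ∈ P, ∀ y ∈ Z * {c}, (p : Γ ⧸ Δ) ≠ y := fun p hp y hy hpy => by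
    obtain ⟨x, hx, hpx⟩ := hPX p hp
    exact hZcX y hy x hx (QuotientGroup.eq.1 (hpy.symm.trans (QuotientGroup.eq.2 hpx)))
  have hinj : Set.InjOn (QuotientGroup.mk (s := Δ)) (P ∪ Z * {c} : Finset Γ) := by
    rw [Finset.coe_union, Set.injOn_union]
    · exact ⟨hP, hZc, hPZc⟩
    · exact Set.disjoint_left.2 fun p hp hp' => hPZc p hp p hp' rfl
  have hsub : ((P ∪ Z * {c} : Finset Γ) : Set Γ) ⊆ N := by
    rw [Finset.coe_union, Finset.coe_mul, Finset.coe_singleton, Set.union_subset_iff]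
    exact ⟨hPN, Set.mul_subset_iff.2 fun z hz y hy => by
      rw [Set.mem_singleton_iff.1 hy]
      exact N.mul_mem (hZN hz) hcN⟩
  obtain ⟨D, hPD, hD, hbd⟩ := hD₀.exists_superset_card_boundary_le hsub hinj E
  refine ⟨D, Z', c, hD, hPD (Finset.mem_union_left _ h1P), hXP.trans (Finset.mul_subset_mul_right
    (Finset.subset_union_left.trans hPD)), Finset.subset_union_right.trans hPD, h1Z', hZ'Δ, hZ',
    hbd.trans (Nat.add_le_add_left (Nat.mul_le_mul_left _ ?_) _)⟩
  calc (P ∪ Z * {c}).card ≤ P.card + (Z * {c}).card := Finset.card_union_le _ _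
    _ ≤ X.card + Z.card := by rw [Finset.card_mul_singleton]; omega

theorem exists_isTransversal_injOn_mul_union [Δ.FiniteIndex] {Z K : Finset Γ}
    (hZN : (Z : Set Γ) ⊆ N) (hZ : Set.InjOn (QuotientGroup.mk (s := H)) Z) (hKN : (K : Set Γ) ⊆ N)
    (hZK : Z ⊆ K) (h1Z : 1 ∈ Z)
    (hinj : Set.InjOn (QuotientGroup.mk (s := Δ)) (Z⁻¹ * K : Finset Γ)) :
    ∃ J : Finset Γ, IsTransversal J (H ⊓ N) Δ ∧ 1 ∈ J ∧
      Set.InjOn (QuotientGroup.mk (s := H ⊓ Δ)) (Z * J ∪ K : Finset Γ) := by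
  classical
  let L := (Z⁻¹ * K).filter (· ∈ H ⊓ N)
  have hL : (L : Set Γ) ⊆ (Z⁻¹ * K : Finset Γ) := fun l hl => (Finset.mem_filter.1 hl).1
  obtain ⟨J, hLJ, hJ⟩ := exists_isTransversal_superset (N := H ⊓ N) (Δ := Δ)
    (fun l hl => (Finset.mem_filter.1 hl).2) (hinj.mono hL)
  have hK : K ⊆ Z⁻¹ * K := Finset.subset_mul_right _ (by simpa using h1Z)
  have hmixed : ∀ y ∈ Z * J, ∀ k ∈ K, (y : Γ ⧸ H ⊓ Δ) = k → y = k := by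
    intro y hy k hk hyk
    obtain ⟨z, hz, j, hj, rfl⟩ := Finset.mem_mul.1 hy
    have hyk : j⁻¹ * (z⁻¹ * k) ∈ H ⊓ Δ := by simpa [mul_assoc] using QuotientGroup.eq.1 hyk
    have hzk : z⁻¹ * k ∈ J := hLJ <| Finset.mem_filter.2
      ⟨Finset.mul_mem_mul (Finset.inv_mem_inv hz) hk,
        (H.mul_mem_cancel_left (H.inv_mem (hJ.subset hj).1)).1 hyk.1,
        N.mul_mem (N.inv_mem (hZN hz)) (hKN hk)⟩
    rw [hJ.injOn hj hzk (QuotientGroup.eq.2 hyk.2), mul_inv_cancel_left]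
  refine ⟨J, hJ, hLJ (Finset.mem_filter.2 ⟨hK (hZK h1Z), one_mem _⟩), ?_⟩
  rintro x hx y hy hxy
  rcases Finset.mem_union.1 hx with hx | hx <;> rcases Finset.mem_union.1 hy with hy | hy
  · obtain ⟨z, hz, j, hj, rfl⟩ := Finset.mem_mul.1 hx
    obtain ⟨z', hz', j', hj', rfl⟩ := Finset.mem_mul.1 hy
    replace hxy : j⁻¹ * (z⁻¹ * z' * j') ∈ H ⊓ Δ := by simpa [mul_assoc] using QuotientGroup.eq.1 hxy
    obtain rfl : z = z' := hZ hz hz' <| QuotientGroup.eq.2 <|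
      (H.mul_mem_cancel_right (hJ.subset hj').1).1
        ((H.mul_mem_cancel_left (H.inv_mem (hJ.subset hj).1)).1 hxy.1)
    rw [inv_mul_cancel, one_mul] at hxy
    rw [hJ.injOn hj hj' (QuotientGroup.eq.2 hxy.2)]
  · exact hmixed x hx y hy hxy
  · exact (hmixed y hy x hx hxy.symm).symm
  · exact hinj (hK hx) (hK hy) (QuotientGroup.eq.2 (QuotientGroup.eq.1 hxy).2)

end TransversalSupersets

section Refinement

variable {Γ : Type*} [Group Γ] {H : Subgroup Γ}

theorem IsTransversal.card_le_relIndex {N Δ : Subgroup Γ} [Δ.FiniteIndex] {J : Finset Γ}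
    (hJ : IsTransversal J (H ⊓ N) Δ) : J.card ≤ Δ.relIndex H :=
  hJ.card_eq.trans_le <|
    Subgroup.relIndex_le_of_le_right inf_le_left Subgroup.FiniteIndex.index_ne_zero

variable [DecidableEq Γ]

/-- A way to assemble the tiles of `ℓ'` from tiles of `ℓ`. The regular shape of `ℓ'` is `F D`, and
its special shape is `F D Z'`, where `Z'` is the set `Z` of `ℓ'`. The special tiles of `ℓ` inside
these two shapes are `F Z c` and the `F Z j` for `j ∈ J`. -/
structure Refinement (ℓ ℓ' : Level H) where
  D : Finset Γ
  J : Finset Γ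
  c : Γ
  le : ℓ'.N ≤ ℓ.N
  F_eq : ℓ'.F = ℓ.F * D
  isTransversal_D : IsTransversal D ℓ.N ℓ'.N
  isTransversal_J : IsTransversal J (H ⊓ ℓ.N) ℓ'.N
  one_mem_J : 1 ∈ J
  mul_J_subset : ℓ.Z * J ⊆ D * ℓ'.Z
  mul_c_subset : ℓ.Z * {c} ⊆ D
  card_lt : ℓ.Z.card * J.card < D.card

namespace Level

theorem exists_refinement_of_isTransversal (ℓ : Level H) {Δ : Subgroup Γ} [Δ.Normal]
    [Δ.FiniteIndex] (hΔ : Δ ≤ ℓ.N) {D J Z : Finset Γ} {c : Γ} (hD : IsTransversal D ℓ.N Δ)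
    (h1D : 1 ∈ D) (hJ : IsTransversal J (H ⊓ ℓ.N) Δ) (h1J : 1 ∈ J) (h1Z : 1 ∈ Z)
    (hZΔ : (Z : Set Γ) ⊆ Δ) (hZ : Set.InjOn (QuotientGroup.mk (s := H)) Z)
    (hZJ : ℓ.Z * J ⊆ D * Z) (hZc : ℓ.Z * {c} ⊆ D) (hcard : ℓ.Z.card * J.card < D.card) :
    ∃ (ℓ' : Level H) (R : Refinement ℓ ℓ'), ℓ'.N = Δ ∧ ℓ'.Z = Z ∧ R.D = D := by
  refine ⟨⟨Δ, ℓ.F * D, Z, ℓ.isTransversal_F.mul hD hΔ le_top, ?_, h1Z, hZΔ, hZ, fun h hh => ?_⟩,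
    ⟨D, J, c, hΔ, rfl, hD, hJ, h1J, hZJ, hZc, hcard⟩, rfl, rfl, rfl⟩
  · simpa using Finset.mul_mem_mul ℓ.one_mem_F h1D
  · obtain ⟨f, hf, z, hz, l, hl, rfl⟩ := ℓ.covers h hh
    obtain ⟨j, hj, hjl⟩ := hJ.exists_inv_mul_mem l hl
    obtain ⟨d, hd, w, hw, hdw⟩ := Finset.mem_mul.1 (hZJ (Finset.mul_mem_mul hz hj))
    refine ⟨f * d, Finset.mul_mem_mul hf hd, w, hw, j⁻¹ * l,
      ⟨H.mul_mem (H.inv_mem (hJ.subset hj).1) hl.1, hjl⟩, ?_⟩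
    rw [mul_assoc f d w, hdw]
    group

theorem exists_refinement_of_injOn (ℓ : Level H) (hH : ¬ H.FiniteIndex) {Δ : Subgroup Γ}
    [Δ.Normal] [Δ.FiniteIndex] (hΔ : Δ ≤ ℓ.N) {K D₀ : Finset Γ} (hZK : ℓ.Z ⊆ K)
    (hKN : (K : Set Γ) ⊆ ℓ.N)
    (hinj : Set.InjOn (QuotientGroup.mk (s := Δ)) (ℓ.Z⁻¹ * K : Finset Γ))
    (hD₀ : IsTransversal D₀ ℓ.N Δ)
    (hcard : ℓ.Z.card * ((2 * ℓ.Z.card + K.card) * Δ.relIndex H) < D₀.card) (E : Finset Γ) :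
    ∃ (ℓ' : Level H) (R : Refinement ℓ ℓ'), ℓ'.N = Δ ∧ K ⊆ R.D * ℓ'.Z ∧
      (boundary E R.D).card ≤ (boundary E D₀).card +
        (1 + E.card) * ((2 * ℓ.Z.card + K.card) * Δ.relIndex H) := by
  obtain ⟨J, hJ, h1J, hX⟩ := exists_isTransversal_injOn_mul_union ℓ.Z_subset ℓ.injOn_Z hKN hZK
    ℓ.one_mem_Z hinj
  have hZ : Set.InjOn (QuotientGroup.mk (s := Δ)) ℓ.Z := hinj.mono <| Finset.coe_subset.2 <|
    hZK.trans (Finset.subset_mul_right _ (by simpa using ℓ.one_mem_Z))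
  have hXN : ((ℓ.Z * J ∪ K : Finset Γ) : Set Γ) ⊆ ℓ.N := by
    rw [Finset.coe_union, Finset.coe_mul, Set.union_subset_iff, Set.mul_subset_iff]
    exact ⟨fun z hz j hj => ℓ.N.mul_mem (ℓ.Z_subset hz) (hJ.subset hj).2, hKN⟩
  have hJcard := hJ.card_le_relIndex
  have hindex : 1 ≤ Δ.relIndex H := (Finset.card_pos.2 ⟨1, h1J⟩).trans_le hJcard
  have hZpos : 1 ≤ ℓ.Z.card := Finset.card_pos.2 ⟨1, ℓ.one_mem_Z⟩
  have hXcard : (ℓ.Z * J ∪ K).card + ℓ.Z.card ≤ (2 * ℓ.Z.card + K.card) * Δ.relIndex H := by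
    have hZJ : (ℓ.Z * J).card ≤ ℓ.Z.card * Δ.relIndex H :=
      Finset.card_mul_le.trans (Nat.mul_le_mul_left _ hJcard)
    nlinarith [Finset.card_union_le (ℓ.Z * J) K]
  obtain ⟨D, Z, c, hD, h1D, hXD, hZc, h1Z, hZΔ, hZinj, hbd⟩ := hD₀.exists_superset_mul hH hΔ hXN hX
    (Finset.mem_union_right _ (hZK ℓ.one_mem_Z)) ℓ.Z_subset hZ
    ((Nat.mul_le_mul_left _ ((Nat.le_add_right _ _).trans hXcard)).trans_lt hcard) E
  have hlt : ℓ.Z.card * J.card < D.card := by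
    rw [hD.card_eq, ← hD₀.card_eq]
    refine (Nat.mul_le_mul_left _ (hJcard.trans ?_)).trans_lt hcard
    exact Nat.le_mul_of_pos_left _ (by omega)
  obtain ⟨ℓ', R, rfl, rfl, rfl⟩ := ℓ.exists_refinement_of_isTransversal hΔ hD h1D hJ h1J h1Z hZΔ
    hZinj (Finset.subset_union_left.trans hXD) hZc hlt
  exact ⟨ℓ', R, rfl, Finset.subset_union_right.trans hXD,
    hbd.trans (Nat.add_le_add_left (Nat.mul_le_mul_left _ hXcard) _)⟩

end Level

theorem isInvariant_of_card_boundary_le {E D D₀ : Finset Γ} {ε : ℝ} (hε : 0 ≤ ε) {h m M : ℕ}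
    (hcard : D.card = D₀.card) (hD₀ : IsInvariant E (ε / 2) D₀) (hm : 2 * m ≤ ε * M)
    (hM : M * h ≤ D₀.card) (hbd : (boundary E D).card ≤ (boundary E D₀).card + m * h) :
    IsInvariant E ε D := by
  rw [isInvariant_iff_card_boundary_le] at hD₀ ⊢
  have hbd : ((boundary E D).card : ℝ) ≤ (boundary E D₀).card + m * h := mod_cast hbd
  have hM : (M * h : ℝ) ≤ D₀.card := mod_cast hM
  have hmh : 2 * (m * h : ℝ) ≤ ε * D₀.card := by
    calc 2 * (m * h : ℝ) = 2 * m * h := by ring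
      _ ≤ ε * M * h := by gcongr
      _ ≤ ε * D₀.card := by rw [mul_assoc]; gcongr
  rw [hcard]
  linarith

theorem Level.exists_refinement [Group.ResiduallyFinite Γ] (hΓ : IsAmenable Γ) {a : Γ}
    (ha : (conjugatesOf a).Infinite) (ℓ : Level (Subgroup.zpowers a)) (K E : Finset Γ) {ε : ℝ}
    (hε : 0 < ε) (B : ℕ) :
    ∃ ℓ' : Level (Subgroup.zpowers a), Nonempty (Refinement ℓ ℓ') ∧ K ⊆ ℓ'.shape .special ∧
      IsInvariant E ε ℓ'.F ∧ B * ℓ'.N.relIndex (Subgroup.zpowers a) ≤ ℓ'.N.index := by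
  classical
  obtain ⟨E', hE'N, hE', hE'E⟩ := ℓ.isTransversal_F.exists_isInvariant_mul E
  let K' := ℓ.Z ∪ (ℓ.F⁻¹ * K).filter (· ∈ ℓ.N)
  have hKK' : K ⊆ ℓ.F * K' := fun k hk => by
    obtain ⟨f, hf, hfk⟩ := ℓ.isTransversal_F.exists_inv_mul_mem k (Subgroup.mem_top k)
    refine Finset.mem_mul.2 ⟨f, hf, f⁻¹ * k, Finset.mem_union_right _ (Finset.mem_filter.2
      ⟨Finset.mul_mem_mul (Finset.inv_mem_inv hf) hk, hfk⟩), mul_inv_cancel_left f k⟩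
  have hK'N : (K' : Set Γ) ⊆ ℓ.N := by
    rw [Finset.coe_union, Set.union_subset_iff]
    exact ⟨ℓ.Z_subset, fun k hk => (Finset.mem_filter.1 hk).2⟩
  obtain ⟨m, hm⟩ : ∃ m, m = 2 * ℓ.Z.card + K'.card := ⟨_, rfl⟩
  obtain ⟨M, hM⟩ := exists_nat_ge (2 * ((1 + E'.card) * m : ℕ) / ε)
  rw [div_le_iff₀' hε] at hM
  obtain ⟨Δ, hΔ, _, _, hinj, hindex, D₀, hD₀, hD₀E'⟩ := exists_normal_isTransversal_isInvariant hΓ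
    ha ℓ.N hE'N hE' (ℓ.Z⁻¹ * K') (half_pos hε) (M + ℓ.Z.card * m + 1 + B)
  have hpos : 0 < Δ.relIndex (Subgroup.zpowers a) :=
    Nat.pos_of_ne_zero Subgroup.FiniteIndex.index_ne_zero
  simp only [add_mul, one_mul, mul_assoc, ← hD₀.card_eq] at hindex
  obtain ⟨ℓ', R, rfl, hKR, hbd⟩ := ℓ.exists_refinement_of_injOn (not_finiteIndex_zpowers ha) hΔ
    Finset.subset_union_left hK'N hinj hD₀ (by rw [← hm]; omega) E'
  rw [← hm, ← mul_assoc] at hbd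
  have hRD : R.D.card = D₀.card := R.isTransversal_D.card_eq.trans hD₀.card_eq.symm
  refine ⟨ℓ', ⟨R⟩, ?_, ?_, ?_⟩
  · rw [Level.shape, R.F_eq, mul_assoc]
    exact hKK'.trans (Finset.mul_subset_mul_left hKR)
  · rw [R.F_eq]
    exact hE'E _ _ R.isTransversal_D.subset
      (isInvariant_of_card_boundary_le hε.le hRD hD₀E' hM (by omega) hbd)
  · rw [hD₀.card_eq] at hindex
    refine (by omega : _ ≤ ℓ'.N.relIndex ℓ.N).trans ?_
    rw [← Subgroup.relIndex_mul_index hΔ]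
    exact Nat.le_mul_of_pos_right _ (Nat.pos_of_ne_zero Subgroup.FiniteIndex.index_ne_zero)

end Refinement

namespace Refinement

variable {Γ : Type*} [Group Γ] [DecidableEq Γ] {H : Subgroup Γ} {ℓ ℓ' : Level H}
  (R : Refinement ℓ ℓ')

/-- The centers of the special tiles of `ℓ` inside a shape of `ℓ'`. -/
def specialCenters : TileKind → Finset Γ
  | .regular => {R.c}
  | .special => R.J

/-- The pieces of level `ℓ` of a shape of `ℓ'`: outside the special tiles it is cut into regular
tiles. -/
def rule (b : TileKind) : Finset (TileKind × Γ) :=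
  {.special} ×ˢ R.specialCenters b ∪
    {.regular} ×ˢ ((R.D * ℓ'.core b) \ (ℓ.Z * R.specialCenters b))

theorem special_mem_rule {b : TileKind} {g : Γ} :
    (.special, g) ∈ R.rule b ↔ g ∈ R.specialCenters b := by
  simp [rule]

theorem regular_mem_rule {b : TileKind} {g : Γ} :
    (.regular, g) ∈ R.rule b ↔ g ∈ R.D * ℓ'.core b ∧ g ∉ ℓ.Z * R.specialCenters b := by
  simp [rule]

theorem mul_specialCenters_subset (b : TileKind) :
    ℓ.Z * R.specialCenters b ⊆ R.D * ℓ'.core b :=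
  match b with
  | .regular => R.mul_c_subset.trans (Finset.subset_mul_left _ (Finset.mem_singleton_self 1))
  | .special => R.mul_J_subset

theorem mul_core_subset (b : TileKind) : ((R.D * ℓ'.core b : Finset Γ) : Set Γ) ⊆ ℓ.N := by
  rw [Finset.coe_mul, Set.mul_subset_iff]
  exact fun d hd w hw => ℓ.N.mul_mem (R.isTransversal_D.subset hd) (R.le (ℓ'.core_subset b hw))

theorem specialCenters_subset (b : TileKind) : (R.specialCenters b : Set Γ) ⊆ ℓ.N := fun _ hg =>
  R.mul_core_subset b <| R.mul_specialCenters_subset b <|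
    Finset.subset_mul_right _ ℓ.one_mem_Z hg

theorem specialCenters_nonempty (b : TileKind) : (R.specialCenters b).Nonempty :=
  match b with
  | .regular => Finset.singleton_nonempty R.c
  | .special => ⟨1, R.one_mem_J⟩

theorem mul_inv_mem_of_mem_specialCenters {b : TileKind} {g g' : Γ} (hg : g ∈ R.specialCenters b)
    (hg' : g' ∈ R.specialCenters b) : g * g'⁻¹ ∈ H := by
  cases b with
  | regular =>
    rw [Finset.mem_singleton.1 hg, Finset.mem_singleton.1 hg', mul_inv_cancel]
    exact H.one_mem
  | special =>
    exact H.mul_mem (R.isTransversal_J.subset hg).1 (H.inv_mem (R.isTransversal_J.subset hg').1)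

theorem eq_of_mul_specialCenters_eq {b : TileKind} {z z' g g' : Γ} (hz : z ∈ ℓ.Z) (hz' : z' ∈ ℓ.Z)
    (hg : g ∈ R.specialCenters b) (hg' : g' ∈ R.specialCenters b) (h : z * g = z' * g') :
    g = g' := by
  obtain rfl : z = z' := ℓ.injOn_Z hz hz' <| QuotientGroup.eq.2 <| by
    convert R.mul_inv_mem_of_mem_specialCenters hg hg' using 1
    rw [inv_mul_eq_iff_eq_mul, ← mul_assoc, h, mul_inv_cancel_right]
  exact mul_left_cancel h

theorem card_specialCenters_le (b : TileKind) : (R.specialCenters b).card ≤ R.J.card :=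
  match b with
  | .regular => Finset.card_pos.2 ⟨1, R.one_mem_J⟩
  | .special => le_rfl

theorem exists_mem_rule (b b' : TileKind) : ∃ g, (b', g) ∈ R.rule b := by
  cases b' with
  | regular =>
    simp only [regular_mem_rule]
    refine Finset.exists_mem_notMem_of_card_lt_card ?_
    calc (ℓ.Z * R.specialCenters b).card
        ≤ ℓ.Z.card * R.J.card :=
          Finset.card_mul_le.trans (Nat.mul_le_mul_left _ (R.card_specialCenters_le b))
      _ < R.D.card := R.card_lt
      _ ≤ (R.D * ℓ'.core b).card := Finset.card_le_card_mul_right ⟨1, ℓ'.one_mem_core b⟩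
  | special =>
    simp only [special_mem_rule]
    exact R.specialCenters_nonempty b

theorem snd_mem_of_mem_rule {b : TileKind} {q : TileKind × Γ} (hq : q ∈ R.rule b) :
    q.2 ∈ ℓ.N := by
  obtain ⟨_ | _, g⟩ := q
  · exact R.mul_core_subset b (R.regular_mem_rule.1 hq).1
  · exact R.specialCenters_subset b (R.special_mem_rule.1 hq)

theorem mem_mul_core_of_mem_rule {b : TileKind} {q : TileKind × Γ} (hq : q ∈ R.rule b) {w : Γ}
    (hw : w ∈ ℓ.core q.1) : w * q.2 ∈ R.D * ℓ'.core b := by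
  obtain ⟨_ | _, g⟩ := q
  · obtain rfl := Finset.mem_singleton.1 hw
    rw [one_mul]
    exact (R.regular_mem_rule.1 hq).1
  · exact R.mul_specialCenters_subset b (Finset.mul_mem_mul hw (R.special_mem_rule.1 hq))

theorem existsUnique_mem_rule {b : TileKind} {w : Γ} (hw : w ∈ R.D * ℓ'.core b) :
    ∃! q, q ∈ R.rule b ∧ w * q.2⁻¹ ∈ ℓ.core q.1 := by
  by_cases hws : w ∈ ℓ.Z * R.specialCenters b
  · obtain ⟨z, hz, g, hg, rfl⟩ := Finset.mem_mul.1 hws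
    refine ⟨(.special, g), ⟨R.special_mem_rule.2 hg, by rwa [mul_inv_cancel_right]⟩, ?_⟩
    rintro ⟨_ | _, g'⟩ ⟨hq, hzg⟩
    · rw [mul_inv_eq_one.1 (Finset.mem_singleton.1 hzg)] at hws
      exact absurd hws (R.regular_mem_rule.1 hq).2
    · rw [R.eq_of_mul_specialCenters_eq hz hzg hg (R.special_mem_rule.1 hq)
        (inv_mul_cancel_right _ _).symm]
  · refine ⟨(.regular, w), ⟨R.regular_mem_rule.2 ⟨hw, hws⟩, ?_⟩, ?_⟩
    · rw [mul_inv_cancel]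
      exact ℓ.one_mem_core _
    rintro ⟨_ | _, g⟩ ⟨hq, hwg⟩
    · rw [mul_inv_eq_one.1 (Finset.mem_singleton.1 hwg)]
    · refine absurd (Finset.mem_mul.2 ⟨_, hwg, g, R.special_mem_rule.1 hq, ?_⟩) hws
      exact inv_mul_cancel_right w g

theorem shape_eq (b : TileKind) : ℓ'.shape b = ℓ.F * (R.D * ℓ'.core b) := by
  rw [Level.shape, R.F_eq, mul_assoc]

theorem tile_subset_shape {b : TileKind} {q : TileKind × Γ} (hq : q ∈ R.rule b) :
    rightTranslate (ℓ.shape q.1) q.2 ⊆ ℓ'.shape b := by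
  intro s hs
  obtain ⟨f, hf, w, hw, hfw⟩ := Finset.mem_mul.1 (mem_rightTranslate.1 hs)
  rw [R.shape_eq, ← inv_mul_cancel_right s q.2, ← hfw, mul_assoc]
  exact Finset.mul_mem_mul hf (R.mem_mul_core_of_mem_rule hq hw)

theorem existsUnique_mem_tile {b : TileKind} {s : Γ} (hs : s ∈ ℓ'.shape b) :
    ∃! q, q ∈ R.rule b ∧ s ∈ rightTranslate (ℓ.shape q.1) q.2 := by
  rw [R.shape_eq] at hs
  obtain ⟨f, hf, w, hw, rfl⟩ := Finset.mem_mul.1 hs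
  refine (existsUnique_congr fun q => and_congr_right fun hq => ?_).2 (R.existsUnique_mem_rule hw)
  exact ℓ.mul_mem_tile_iff hf (R.mul_core_subset b hw) (R.snd_mem_of_mem_rule hq)

end Refinement

/-- A sequence of levels, each one refined by the next, whose special shapes exhaust the group,
whose tiles are asymptotically invariant and meet `H` in a vanishing proportion. -/
structure Tower {Γ : Type*} [Group Γ] [DecidableEq Γ] (H : Subgroup Γ) where
  level : ℕ → Level H
  refinement : ∀ n, Refinement (level n) (level (n + 1))
  exhausts : ∀ g, ∃ n, g ∈ (level n).shape .special
  eventually_isInvariant : ∀ (E : Finset Γ) (ε : ℝ), 0 < ε →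
    ∀ᶠ n in atTop, IsInvariant E ε (level n).F
  mul_relIndex_le : ∀ n, n * (level n).N.relIndex H ≤ (level n).N.index

namespace Tower

variable {Γ : Type*} [Group Γ] [DecidableEq Γ] {H : Subgroup Γ} (τ : Tower H)

/-- The substitution that cuts every tile of level `n + 1` into tiles of level `n`. -/
def substitution : Substitution Γ TileKind where
  root := .special
  shape n := (τ.level n).shape
  rule n := (τ.refinement n).rule
  rule_subset n _ _ hq := (τ.refinement n).tile_subset_shape hq
  rule_unique n _ _ hs := (τ.refinement n).existsUnique_mem_tile hs
  one_mem_shape n := (τ.level n).one_mem_shape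
  root_mem_rule n := (τ.refinement n).special_mem_rule.2 (τ.refinement n).one_mem_J
  rule_occurs n := (τ.refinement n).exists_mem_rule
  exhausts := τ.exhausts

theorem snd_mem_of_mem_level {n : ℕ} {p : TileKind × Γ} (hp : p ∈ τ.substitution.level n) :
    p.2 ∈ (τ.level n).N := by
  obtain ⟨k, hk⟩ := Set.mem_iUnion.1 hp
  clear hp
  induction k generalizing n p with
  | zero =>
    rw [Set.mem_singleton_iff.1 hk]
    exact one_mem _
  | succ k ih =>
    obtain ⟨q, hq, r, hr, rfl⟩ := hk
    exact mul_mem ((τ.refinement n).snd_mem_of_mem_rule hr) ((τ.refinement n).le (ih hq))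

theorem exists_special_mem_pieces (k : ℕ) {n : ℕ} {h : Γ} (hh : h ∈ H ⊓ (τ.level n).N) :
    ∃ p, (.special, p) ∈ τ.substitution.pieces k n ∧ p⁻¹ * h ∈ H ⊓ (τ.level (n + k)).N := by
  induction k generalizing n h with
  | zero => exact ⟨1, rfl, by simpa using hh⟩
  | succ k ih =>
    have hJ := (τ.refinement n).isTransversal_J
    obtain ⟨j, hj, hjh⟩ := hJ.exists_inv_mul_mem h hh
    obtain ⟨p, hp, hph⟩ := ih (n := n + 1) ⟨H.mul_mem (H.inv_mem (hJ.subset hj).1) hh.1, hjh⟩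
    refine ⟨j * p, ⟨(.special, p), hp, (.special, j), ?_, rfl⟩, ?_⟩
    · exact (τ.refinement n).special_mem_rule.2 hj
    · rwa [mul_inv_rev, mul_assoc, show n + (k + 1) = n + 1 + k by omega]

theorem special_mem_level {n : ℕ} {h : Γ} (hh : h ∈ H ⊓ (τ.level n).N) :
    (.special, h) ∈ τ.substitution.level n := by
  obtain ⟨m, hm⟩ := τ.exhausts h
  obtain ⟨p, hp, hph⟩ := τ.exists_special_mem_pieces m hh
  have hmem : p ∈ (τ.level (n + m)).shape .special :=
    τ.substitution.tile_subset_of_mem_pieces hp <| mem_rightTranslate.2 <| by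
      rw [mul_inv_cancel]
      exact (τ.level n).one_mem_shape .special
  obtain rfl : p = h := (τ.level (n + m)).injOn_shape_special hmem
    (τ.substitution.shape_mono (Nat.le_add_left m n) hm) (QuotientGroup.eq.2 hph)
  exact Set.mem_iUnion.2 ⟨m, hp⟩

theorem isFolnerTilingSeq : IsFolnerTilingSeq τ.substitution.tiling := by
  intro E ε hε
  obtain ⟨n₀, hn₀⟩ := eventually_atTop.1 (τ.eventually_isInvariant E ε hε)
  refine ⟨n₀, fun n hn S hS => ?_⟩
  obtain ⟨b, rfl⟩ := τ.substitution.isShape_iff.1 hS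
  exact (τ.level n).isInvariant_shape (hn₀ n hn) b

theorem le_card_F (n : ℕ) : n ≤ (τ.level n).F.card := by
  rw [Level.card_F]
  exact (Nat.le_mul_of_pos_right n (Nat.pos_of_ne_zero Subgroup.FiniteIndex.index_ne_zero)).trans
    (τ.mul_relIndex_le n)

theorem tendsto_entropy [Infinite Γ] {F : ℕ → Finset Γ} (hF : IsFolnerSeq F) :
    Tendsto (fun n => (τ.substitution.tiling n).entropy F) atTop (𝓝 0) := by
  have hlim : Tendsto (fun n : ℕ =>
      ((2 * Real.log (Fintype.card TileKind + 1 : ℕ) / n : ℝ) : EReal)) atTop (𝓝 0) :=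
    (continuous_coe_real_ereal.tendsto 0).comp (tendsto_const_div_atTop_nhds_zero_nat _)
  refine tendsto_of_tendsto_of_tendsto_of_le_of_le' tendsto_const_nhds hlim
    (Eventually.of_forall fun n => topEntropy_nonneg F) ?_
  filter_upwards [eventually_gt_atTop 0] with n hn
  have hle := τ.substitution.entropy_le n (fun p hp => τ.snd_mem_of_mem_level hp)
    ⟨1, (τ.level n).one_mem_F⟩ (τ.level n).isTransversal_F.injOn hF
  refine hle.trans (EReal.coe_le_coe_iff.2 ?_)
  have hcard := τ.le_card_F n
  gcongr

theorem exists_forall_ncard_inter_tile_le {δ : ℝ} (hδ : 0 < δ) :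
    ∃ n₀, ∀ n ≥ n₀, ∀ T, (τ.substitution.tiling n).IsTile T →
      (((H : Set Γ) ∩ T).ncard : ℝ) ≤ δ * T.card := by
  obtain ⟨n₀, hn₀⟩ := exists_nat_gt (1 / δ)
  rw [div_lt_iff₀' hδ] at hn₀
  refine ⟨n₀, ?_⟩
  rintro n hn _ ⟨_, c, hc, rfl⟩
  obtain ⟨b, rfl, -⟩ := τ.substitution.isCenter_iff.1 hc
  set T := rightTranslate (τ.substitution.shape n b) c
  calc (((H : Set Γ) ∩ T).ncard : ℝ)
      ≤ δ * n * ((H : Set Γ) ∩ T).ncard := by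
        refine le_mul_of_one_le_left (Nat.cast_nonneg _) (hn₀.le.trans ?_)
        gcongr
    _ = δ * (n * ((H : Set Γ) ∩ T).ncard : ℕ) := by push_cast; ring
    _ ≤ δ * T.card := by
        gcongr
        exact (τ.level n).mul_ncard_inter_tile_le (τ.mul_relIndex_le n) b c

theorem realizesPropertyID (hcyclic : IsCyclic H) (hinfinite : Infinite H)
    (hindex : ¬ H.FiniteIndex) : RealizesPropertyID H τ.substitution.tiling where
  isCyclic := hcyclic
  infinite := hinfinite
  infinite_index := hindex
  tightlyNested := τ.substitution.isTightlyNested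
  folner := τ.isFolnerTilingSeq
  syndetic n p hp := by
    obtain ⟨b, rfl⟩ := τ.substitution.mem_pairs.1 hp
    exact τ.substitution.isSyndetic_centers n b
  entropy_tendsto F hF := by
    have : Infinite Γ := Infinite.of_injective _ (Subtype.val_injective (p := (· ∈ H)))
    exact τ.tendsto_entropy hF
  finset_subset_tile := τ.substitution.finset_subset_tile
  thin _ := τ.exists_forall_ncard_inter_tile_le
  covers n := by
    refine ⟨(τ.level n).shape .special, H ⊓ (τ.level n).N, inf_le_left,
      τ.substitution.isShape_iff.2 ⟨.special, rfl⟩, fun c hc =>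
        τ.substitution.isCenter_iff.2 ⟨.special, rfl, τ.special_mem_level hc⟩, fun h hh => ?_⟩
    obtain ⟨f, hf, z, hz, l, hl, rfl⟩ := (τ.level n).covers h hh
    exact ⟨l, hl, mul_mem_rightTranslate (Finset.mul_mem_mul hf hz)⟩

end Tower

theorem nonempty_tower {Γ : Type*} [Group Γ] [DecidableEq Γ] [Countable Γ]
    [Group.ResiduallyFinite Γ] (hΓ : IsAmenable Γ) {a : Γ} (ha : (conjugatesOf a).Infinite) :
    Nonempty (Tower (Subgroup.zpowers a)) := by
  obtain ⟨E, hE⟩ := exists_seq_tendsto (atTop : Filter (Finset Γ))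
  choose next hnext hEsub hinv hindex using fun (n : ℕ) (ℓ : Level (Subgroup.zpowers a)) =>
    ℓ.exists_refinement hΓ ha (E n) (E n) (ε := 1 / (n + 1)) Nat.one_div_pos_of_nat (n + 1)
  let level : ℕ → Level (Subgroup.zpowers a) := fun n => Nat.rec (Level.top _) next n
  refine ⟨⟨level, fun n => (hnext n (level n)).some, fun g => ?_, fun K ε hε => ?_, ?_⟩⟩
  · obtain ⟨n, hn⟩ := (hE.eventually_ge_atTop {g}).exists
    exact ⟨n + 1, hEsub n (level n) (Finset.singleton_subset_iff.1 hn)⟩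
  · rw [← map_add_atTop_eq_nat 1, eventually_map]
    filter_upwards [hE.eventually_ge_atTop K,
      tendsto_one_div_add_atTop_nhds_zero_nat.eventually_le_const hε] with n hK hn
    exact (hinv n (level n)).mono hK hn
  · rintro (_ | n)
    · rw [zero_mul]
      exact Nat.zero_le _
    · exact hindex n (level n)

end PropID

theorem mainTheorem12 {Γ : Type*} [Group Γ] [Countable Γ] [Group.ResiduallyFinite Γ]
    (hΓ : PropID.IsAmenable Γ)
    (ha : ∃ a : Γ, ¬ IsOfFinOrder a ∧ (conjugatesOf a).Infinite) :
    PropID.HasPropertyID Γ := by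
  classical
  obtain ⟨a, ha, hconj⟩ := ha
  obtain ⟨τ⟩ := PropID.nonempty_tower hΓ hconj
  exact ⟨Subgroup.zpowers a, τ.substitution.tiling, τ.realizesPropertyID inferInstance
    (Set.infinite_coe_iff.2 (infinite_zpowers.2 ha)) (PropID.not_finiteIndex_zpowers hconj)⟩
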